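/- **Theorem.** Let $G$ be a linearly complex reductive Lie group, that is, a (finite-dimensional) complex Lie group for which there are a compact real Lie group $K$ and a homomorphism of real Lie groups $\eta\colon K\to G$ making $G$ the universal complexification of $K$: for every homomorphism of real Lie groups $\alpha\colon K\to H$ into a complex Lie group $H$ there is a unique holomorphic homomorphism $\alpha'\colon G\to H$ with $\alpha'\circ\eta=\alpha$. (Connectedness is not assumed.) Let $\mathcal O(G)$ be the space of holomorphic functions on $G$ with the topology of uniform convergence on compact subsets, and let $\mathscr A(G)$ be its strong dual (continuous linear functionals with the topology of uniform convergence on bounded subsets), with the convolution $\langle\alpha\beta,f\rangle=(\alpha\otimes\beta)(\Delta f)$, $(\Delta f)(g,h)=f(gh)$, and with unit $\delta_e$. Then $\mathscr A(G)$ is a homologically trivial (contractible) $\widehat\otimes$-algebra. Explicitly: $\mathscr A(G)$ is a $\widehat\otimes$-algebra, i.e. a unital complete Hausdorff locally convex algebra over $\mathbb C$ with jointly continuous multiplication, and it is projective as an $\mathscr A(G)$-$\widehat\otimes$-bimodule. Here an $A$-$\widehat\otimes$-bimodule is a complete Hausdorff locally convex space that is a unital $A$-bimodule with jointly continuous left and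 right actions; morphisms are the continuous bimodule homomorphisms; and a bimodule $P$ is projective if for every morphism $\sigma\colon X\to Y$ of $A$-$\widehat\otimes$-bimodules that has a continuous linear right inverse, and every morphism $\varphi\colon P\to Y$, there is a morphism $\tau\colon P\to X$ with $\sigma\circ\tau=\varphi$. -/

import Mathlib

open scoped Manifold ContDiff Topology

universe w u v

noncomputable section

/-! ### Holomorphic functions on a complex manifold -/

/-- The linear subspace of all holomorphic functions in `C(M, ℂ)`, for a complex manifold `M`
modelled on `E`. -/
def holomorphicSubmodule (E : Type*) [NormedAddCommGroup E] [NormedSpace ℂ E]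
    (M : Type*) [TopologicalSpace M] [ChartedSpace E M] : Submodule ℂ C(M, ℂ) where
  carrier := {f | MDifferentiable 𝓘(ℂ, E) 𝓘(ℂ, ℂ) f}
  add_mem' := fun hf hg => hf.add hg
  zero_mem' := mdifferentiable_const
  smul_mem' := fun c _ hf => hf.const_smul c

/-- The space `𝒪(M)` of all holomorphic functions on a complex manifold `M` modelled on `E`,
with the topology of uniform convergence on compact sets (the topology induced by the
compact-open topology of `C(M, ℂ)`). -/
def HolomorphicFunctions (E : Type*) [NormedAddCommGroup E] [NormedSpace ℂ E]
    (M : Type*) [TopologicalSpace M] [ChartedSpace E M] : Type _ :=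
  holomorphicSubmodule E M

namespace HolomorphicFunctions

variable {E : Type*} [NormedAddCommGroup E] [NormedSpace ℂ E]
  {M : Type*} [TopologicalSpace M] [ChartedSpace E M]

instance : AddCommGroup (HolomorphicFunctions E M) :=
  inferInstanceAs (AddCommGroup (holomorphicSubmodule E M))

instance : Module ℂ (HolomorphicFunctions E M) :=
  inferInstanceAs (Module ℂ (holomorphicSubmodule E M))

instance : TopologicalSpace (HolomorphicFunctions E M) :=
  inferInstanceAs (TopologicalSpace (holomorphicSubmodule E M))

instance : IsTopologicalAddGroup (HolomorphicFunctions E M) :=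
  inferInstanceAs (IsTopologicalAddGroup (holomorphicSubmodule E M))

instance : ContinuousSMul ℂ (HolomorphicFunctions E M) :=
  inferInstanceAs (ContinuousSMul ℂ (holomorphicSubmodule E M))

/-- The inclusion `𝒪(M) → C(M, ℂ)`. -/
def toContinuousMap : HolomorphicFunctions E M →L[ℂ] C(M, ℂ) :=
  (holomorphicSubmodule E M).subtypeL

instance : FunLike (HolomorphicFunctions E M) M ℂ where
  coe f := toContinuousMap f
  coe_injective _ _ h := Subtype.ext (DFunLike.coe_injective h)

@[ext]
theorem ext {f g : HolomorphicFunctions E M} (h : ∀ x, f x = g x) : f = g :=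
  DFunLike.ext _ _ h

@[simp] theorem toContinuousMap_apply (f : HolomorphicFunctions E M) (x : M) :
    toContinuousMap f x = f x := rfl

@[simp] theorem add_apply (f g : HolomorphicFunctions E M) (x : M) : (f + g) x = f x + g x := rfl

@[simp] theorem smul_apply (c : ℂ) (f : HolomorphicFunctions E M) (x : M) :
    (c • f) x = c * f x := rfl

theorem mdifferentiable (f : HolomorphicFunctions E M) :
    MDifferentiable 𝓘(ℂ, E) 𝓘(ℂ, ℂ) f := f.2

protected theorem continuous (f : HolomorphicFunctions E M) : Continuous f :=
  (toContinuousMap f).continuous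

theorem isInducing_toContinuousMap :
    Topology.IsInducing (toContinuousMap : HolomorphicFunctions E M → C(M, ℂ)) :=
  Topology.IsInducing.subtypeVal

/-- A holomorphic function, as an element of `𝒪(M)`. -/
def mk (f : M → ℂ) (hf : MDifferentiable 𝓘(ℂ, E) 𝓘(ℂ, ℂ) f) : HolomorphicFunctions E M :=
  ⟨⟨f, hf.continuous⟩, hf⟩

@[simp] theorem mk_apply (f : M → ℂ) (hf : MDifferentiable 𝓘(ℂ, E) 𝓘(ℂ, ℂ) f) (x : M) :
    mk f hf x = f x := rfl

end HolomorphicFunctions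

/-- The space `𝒜(M)` of analytic functionals on a complex manifold `M`: the strong dual of `𝒪(M)`,
i.e. the space of continuous linear functionals with the topology of uniform convergence on
bounded subsets. -/
def AnalyticFunctional (E : Type*) [NormedAddCommGroup E] [NormedSpace ℂ E]
    (M : Type*) [TopologicalSpace M] [ChartedSpace E M] : Type _ :=
  StrongDual ℂ (HolomorphicFunctions E M)

namespace AnalyticFunctional

section Space

variable {E : Type*} [NormedAddCommGroup E] [NormedSpace ℂ E]
  {M : Type*} [TopologicalSpace M] [ChartedSpace E M]

instance : AddCommGroup (AnalyticFunctional E M) :=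
  inferInstanceAs (AddCommGroup (StrongDual ℂ (HolomorphicFunctions E M)))

instance : Module ℂ (AnalyticFunctional E M) :=
  inferInstanceAs (Module ℂ (StrongDual ℂ (HolomorphicFunctions E M)))

instance : UniformSpace (AnalyticFunctional E M) :=
  inferInstanceAs (UniformSpace (StrongDual ℂ (HolomorphicFunctions E M)))

instance : FunLike (AnalyticFunctional E M) (HolomorphicFunctions E M) ℂ :=
  inferInstanceAs (FunLike (StrongDual ℂ (HolomorphicFunctions E M)) (HolomorphicFunctions E M) ℂ)

instance : ContinuousLinearMapClass (AnalyticFunctional E M) ℂ (HolomorphicFunctions E M) ℂ :=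
  inferInstanceAs (ContinuousLinearMapClass (StrongDual ℂ (HolomorphicFunctions E M)) ℂ
    (HolomorphicFunctions E M) ℂ)

@[ext]
theorem ext {α β : AnalyticFunctional E M} (h : ∀ f, α f = β f) : α = β :=
  DFunLike.ext _ _ h

@[simp] theorem add_apply (α β : AnalyticFunctional E M) (f : HolomorphicFunctions E M) :
    (α + β) f = α f + β f := rfl

@[simp] theorem zero_apply (f : HolomorphicFunctions E M) :
    (0 : AnalyticFunctional E M) f = 0 := rfl

@[simp] theorem smul_apply (c : ℂ) (α : AnalyticFunctional E M) (f : HolomorphicFunctions E M) :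
    (c • α) f = c * α f := rfl

/-- The delta function `δ_x : f ↦ f x`. -/
def delta (x : M) : AnalyticFunctional E M :=
  ((ContinuousMap.evalCLM ℂ x).comp HolomorphicFunctions.toContinuousMap :
    StrongDual ℂ (HolomorphicFunctions E M))

@[simp] theorem delta_apply (x : M) (f : HolomorphicFunctions E M) :
    delta x f = f x := rfl

open scoped ComplexOrder in
/-- Every analytic functional extends to a continuous linear functional on `C(M, ℂ)`. -/
theorem exists_extension (β : AnalyticFunctional E M) :
    ∃ γ : StrongDual ℂ C(M, ℂ), ∀ f : HolomorphicFunctions E M,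
      γ f.toContinuousMap = β f := by
  have : LocallyConvexSpace ℂ ℂ :=
    .ofBasisZero ℂ ℂ _ _ Metric.nhds_basis_ball fun ε _ =>
      convex_of_nonneg_surjective_algebraMap _ (fun c hc => by
        obtain ⟨x, hx, h⟩ := RCLike.nonneg_iff_exists_ofReal.mp (show (0 : ℂ) ≤ c from hc)
        exact ⟨x, hx, h⟩)
        (convex_ball (0 : ℂ) ε)
  have : PolynormableSpace ℂ C(M, ℂ) := LocallyConvexSpace.toPolynormableSpace
  exact StrongDual.exists_extension (holomorphicSubmodule E M)
    (β : StrongDual ℂ (HolomorphicFunctions E M))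

end Space

/-! ### Holomorphic dependence on a parameter -/

section Parameter

variable {E : Type*} [NormedAddCommGroup E] [NormedSpace ℂ E] {X : Type*} [TopologicalSpace X]

/-- Second-order Cauchy estimate. -/
theorem norm_sub_sub_fderiv_le {u : E → ℂ} {c : E} {r C : ℝ} (hr : 0 < r)
    (hu : DifferentiableOn ℂ u (Metric.ball c r)) (hC : ∀ z ∈ Metric.ball c r, ‖u z‖ ≤ C)
    {z : E} (hz : z ∈ Metric.ball c r) :
    ‖u z - u c - fderiv ℂ u c (z - c)‖ ≤ 4 * C * (‖z - c‖ / r) ^ 2 := by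
  have hc : c ∈ Metric.ball c r := Metric.mem_ball_self hr
  have hmaps : Set.MapsTo u (Metric.ball c r) (Metric.closedBall (u c) (2 * C)) := by
    intro w hw
    rw [mem_closedBall_iff_norm]
    linarith [norm_sub_le (u w) (u c), hC w hw, hC c hc]
  have hd := Complex.norm_fderiv_le_div_of_mapsTo_ball hu hmaps hr
  have hda : HasFDerivAt u (fderiv ℂ u c) c :=
    (hu.differentiableAt (Metric.isOpen_ball.mem_nhds hc)).hasFDerivAt
  let v : E → ℂ := fun w => u w - fderiv ℂ u c (w - c)
  have key := Complex.dist_le_mul_div_pow_of_mapsTo_ball_of_isLittleO (f := v) (c := c) (R₁ := r)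
    (R₂ := 4 * C) (n := 1) (z := z) ?_ ?_ ?_ hz
  · simpa [v, dist_eq_norm_sub, sub_right_comm] using key
  · exact hu.sub (by fun_prop)
  · intro w hw
    have h1 := hmaps hw
    rw [mem_closedBall_iff_norm] at h1 ⊢
    have h2 : ‖fderiv ℂ u c (w - c)‖ ≤ 2 * C := by
      refine ((fderiv ℂ u c).le_opNorm _).trans ?_
      have h3 : ‖w - c‖ ≤ r := (mem_ball_iff_norm.1 hw).le
      calc _ ≤ 2 * C / r * r := mul_le_mul hd h3 (norm_nonneg _) ((norm_nonneg _).trans hd)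
        _ = 2 * C := by field_simp
    have h4 : v w - v c = (u w - u c) - fderiv ℂ u c (w - c) := by simp [v]; ring
    rw [h4]
    linarith [norm_sub_le (u w - u c) (fderiv ℂ u c (w - c))]
  · have := hda.isLittleO
    simp only [pow_one]
    refine (this.norm_right).congr_left fun w => ?_
    simp [v]; ring

/-- A continuous linear functional on `C(X, ℂ)` is bounded by a multiple of the maximum on a
compact set. -/
theorem exists_isCompact_bound (β : StrongDual ℂ C(X, ℂ)) :
    ∃ (L : Set X) (C : ℝ), IsCompact L ∧ 0 < C ∧
      ∀ (φ : C(X, ℂ)) (m : ℝ), 0 < m → (∀ x ∈ L, ‖φ x‖ ≤ m) → ‖β φ‖ ≤ C * m := by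
  have h1 : {φ : C(X, ℂ) | ‖β φ‖ < 1} ∈ 𝓝 (0 : C(X, ℂ)) := by
    refine (isOpen_lt (by fun_prop) continuous_const).mem_nhds ?_
    simp
  obtain ⟨⟨L, ε⟩, ⟨hL, hε⟩, hs⟩ :=
    ((Metric.nhds_basis_ball (x := (0 : ℂ))).nhds_continuousMapConst (X := X)).mem_iff.1 h1
  refine ⟨L, 2 / ε, hL, by positivity, fun φ m hm hφ => ?_⟩
  have hk : ‖β (((ε / (2 * m) : ℝ) : ℂ) • φ)‖ < 1 := by
    apply hs
    intro x hx
    have := hφ x hx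
    simp only [ContinuousMap.smul_apply, mem_ball_zero_iff, norm_smul, Complex.norm_real,
      Real.norm_eq_abs, abs_of_pos (show 0 < ε / (2 * m) by positivity)]
    calc _ ≤ ε / (2 * m) * m := by gcongr
      _ = ε / 2 := by field_simp
      _ < ε := by linarith
  rw [map_smul, norm_smul, Complex.norm_real, Real.norm_eq_abs,
    abs_of_pos (show 0 < ε / (2 * m) by positivity)] at hk
  rw [show 2 / ε * m = 1 / (ε / (2 * m)) by field_simp, le_div_iff₀ (by positivity)]
  linarith

/-- A continuous linear functional applied to a function depending holomorphically on a parameter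
depends holomorphically on the parameter. -/
theorem differentiableAt_apply [FiniteDimensional ℂ E] (β : StrongDual ℂ C(X, ℂ)) (Φ : E → C(X, ℂ)) {c : E} {R : ℝ}
    (hR : 0 < R) (hcont : ContinuousOn (fun p : E × X => Φ p.1 p.2) (Metric.ball c R ×ˢ Set.univ))
    (hdiff : ∀ x, DifferentiableOn ℂ (fun z => Φ z x) (Metric.ball c R)) :
    DifferentiableAt ℂ (fun z => β (Φ z)) c := by
  have : ProperSpace E := FiniteDimensional.proper ℂ E
  set r := R / 2 with hr_def
  have hr : 0 < r := by positivity
  have hsub : Metric.closedBall c r ⊆ Metric.ball c R :=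
    Metric.closedBall_subset_ball (by linarith)
  have hsub' : Metric.ball c r ⊆ Metric.ball c R := Metric.ball_subset_ball (by linarith)
  let S := Metric.closedBall c r
  have hS : CompactSpace S := isCompact_iff_compactSpace.1 (isCompact_closedBall c r)
  -- the restrictions to the closed ball depend continuously on the point of `X`
  let q : C(X × S, ℂ) := ⟨fun p => Φ p.2.1 p.1, by
    have h : Continuous fun p : X × S => ((p.2.1, p.1) : E × X) := by fun_prop
    exact hcont.comp_continuous h fun p => ⟨hsub p.2.2, trivial⟩⟩
  have hq : Continuous (ContinuousMap.curry q) := (ContinuousMap.curry q).continuous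
  have hD : ∀ w : E, Continuous fun x => fderiv ℂ (fun z => Φ z x) c w := by
    intro w
    rw [Metric.continuous_iff']
    intro x ε hε
    have hq' := Metric.continuous_iff'.1 hq x (ε * r / (2 * (‖w‖ + 1))) (by positivity)
    filter_upwards [hq'] with y hy
    have hb : ∀ z ∈ Metric.ball c r, ‖Φ z y - Φ z x‖ ≤ ε * r / (2 * (‖w‖ + 1)) := by
      intro z hz
      have := ContinuousMap.dist_apply_le_dist (f := ContinuousMap.curry q y)
        (g := ContinuousMap.curry q x) ⟨z, Metric.ball_subset_closedBall hz⟩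
      rw [dist_eq_norm_sub] at this
      exact this.trans hy.le
    have hy1 := (hdiff y).mono hsub'
    have hx1 := (hdiff x).mono hsub'
    have hmaps : Set.MapsTo (fun z => Φ z y - Φ z x) (Metric.ball c r)
        (Metric.closedBall (Φ c y - Φ c x) (2 * (ε * r / (2 * (‖w‖ + 1))))) := by
      intro z hz
      rw [mem_closedBall_iff_norm]
      linarith [norm_sub_le (Φ z y - Φ z x) (Φ c y - Φ c x), hb z hz,
        hb c (Metric.mem_ball_self hr)]
    have h1 := Complex.norm_fderiv_le_div_of_mapsTo_ball (hy1.sub hx1) hmaps hr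
    have hn := Metric.isOpen_ball.mem_nhds (Metric.mem_ball_self hr : c ∈ Metric.ball c r)
    have h2 : fderiv ℂ (fun z => Φ z y - Φ z x) c
        = fderiv ℂ (fun z => Φ z y) c - fderiv ℂ (fun z => Φ z x) c :=
      fderiv_fun_sub (hy1.differentiableAt hn) (hx1.differentiableAt hn)
    have h1' : ‖fderiv ℂ (fun z => Φ z y) c - fderiv ℂ (fun z => Φ z x) c‖
        ≤ ε / (‖w‖ + 1) := by
      rw [← h2]
      refine h1.trans (le_of_eq ?_)
      field_simp
    rw [dist_eq_norm_sub, ← sub_apply]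
    refine (ContinuousLinearMap.le_opNorm _ _).trans_lt ?_
    calc _ ≤ ε / (‖w‖ + 1) * ‖w‖ := by gcongr
      _ < ε := by
        rw [div_mul_eq_mul_div, div_lt_iff₀ (by positivity)]
        nlinarith [norm_nonneg w]
  let T : E →ₗ[ℂ] C(X, ℂ) :=
    { toFun := fun w => ⟨fun x => fderiv ℂ (fun z => Φ z x) c w, hD w⟩
      map_add' := fun v w => by ext x; simp
      map_smul' := fun a w => by ext x; simp }
  obtain ⟨L, C, hL, hC, hβ⟩ := exists_isCompact_bound β
  obtain ⟨m, hm⟩ : ∃ m, ∀ p ∈ S ×ˢ L, ‖Φ p.1 p.2‖ ≤ m :=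
    ((isCompact_closedBall c r).prod hL).exists_bound_of_continuousOn
      (f := fun p : E × X => Φ p.1 p.2) (hcont.mono (Set.prod_mono hsub (Set.subset_univ _)))
  set m' := max m 1
  have hm' : 0 < m' := lt_max_of_lt_right one_pos
  refine HasFDerivAt.differentiableAt
    (f' := LinearMap.toContinuousLinearMap (β.toLinearMap ∘ₗ T)) ?_
  rw [hasFDerivAt_iff_isLittleO]
  have hO : (fun z => β (Φ z) - β (Φ c)
      - LinearMap.toContinuousLinearMap (β.toLinearMap ∘ₗ T) (z - c))
      =O[𝓝 c] fun z => ‖z - c‖ ^ 2 := by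
    refine Asymptotics.IsBigO.of_bound (C * (4 * m' / r ^ 2)) ?_
    filter_upwards [Metric.ball_mem_nhds c hr] with z hz
    rcases eq_or_ne z c with rfl | hzc
    · simp
    have hpos : 0 < ‖z - c‖ := norm_pos_iff.2 (sub_ne_zero.2 hzc)
    have e : β (Φ z) - β (Φ c) - LinearMap.toContinuousLinearMap (β.toLinearMap ∘ₗ T) (z - c)
        = β (Φ z - Φ c - T (z - c)) := by simp
    rw [e]
    refine (hβ _ (4 * m' * (‖z - c‖ / r) ^ 2) (by positivity) fun x hx => ?_).trans (le_of_eq ?_)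
    · exact norm_sub_sub_fderiv_le hr ((hdiff x).mono hsub')
        (fun w hw => (hm (w, x) ⟨Metric.ball_subset_closedBall hw, hx⟩).trans (le_max_left _ _)) hz
    · rw [Real.norm_eq_abs, abs_of_nonneg (by positivity)]
      field_simp
  refine hO.trans_isLittleO ?_
  have h0 : (fun z : E => ‖z - c‖ ^ 2) =o[𝓝 c] fun z => ‖z - c‖ ^ 1 := by
    have := (Asymptotics.isLittleO_pow_pow (𝕜 := ℝ) (m := 1) (n := 2) (by norm_num)).comp_tendsto
      (show Filter.Tendsto (fun z : E => ‖z - c‖) (𝓝 c) (𝓝 0) from by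
        have : Continuous fun z : E => ‖z - c‖ := by fun_prop
        simpa using this.tendsto c)
    exact this
  simpa using h0

end Parameter

/-! ### The convolution algebra of a complex Lie group -/

section Unit

variable {E : Type*} [NormedAddCommGroup E] [NormedSpace ℂ E]
  {G : Type*} [TopologicalSpace G] [ChartedSpace E G] [Group G]

/-- The unit is the delta function at the identity of the group. -/
instance : One (AnalyticFunctional E G) where
  one := delta 1

theorem one_apply (f : HolomorphicFunctions E G) : (1 : AnalyticFunctional E G) f = f 1 := rfl

end Unit

section Convolution

variable {E : Type*} [NormedAddCommGroup E] [NormedSpace ℂ E]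
  {G : Type*} [TopologicalSpace G] [ChartedSpace E G] [Group G] [LieGroup 𝓘(ℂ, E) ω G]

/-- The function `h ↦ f (g * h)`. -/
def leftTranslate (g : G) (f : HolomorphicFunctions E G) : HolomorphicFunctions E G :=
  .mk (fun h => f (g * h)) <|
    f.mdifferentiable.comp ((contMDiff_mul_left (I := 𝓘(ℂ, E)) (n := ω)).mdifferentiable (by simp))

@[simp] theorem leftTranslate_apply (g h : G) (f : HolomorphicFunctions E G) :
    leftTranslate g f h = f (g * h) := rfl

theorem leftTranslate_add (g : G) (f₁ f₂ : HolomorphicFunctions E G) :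
    leftTranslate g (f₁ + f₂) = leftTranslate g f₁ + leftTranslate g f₂ := rfl

theorem leftTranslate_smul (g : G) (c : ℂ) (f : HolomorphicFunctions E G) :
    leftTranslate g (c • f) = c • leftTranslate g f := rfl

theorem leftTranslate_mul (g h : G) (f : HolomorphicFunctions E G) :
    leftTranslate (g * h) f = leftTranslate h (leftTranslate g f) :=
  HolomorphicFunctions.ext fun x => by simp [mul_assoc]

theorem leftTranslate_one (f : HolomorphicFunctions E G) :
    leftTranslate (1 : G) f = f :=
  HolomorphicFunctions.ext fun x => by simp

variable [FiniteDimensional ℂ E]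

/-- For an analytic functional `β` and a holomorphic function `f`, the function
`g ↦ ⟨β, h ↦ f (g * h)⟩` is holomorphic. -/
theorem mdifferentiable_apply_leftTranslate (β : AnalyticFunctional E G)
    (f : HolomorphicFunctions E G) :
    MDifferentiable 𝓘(ℂ, E) 𝓘(ℂ, ℂ) fun g : G => β (leftTranslate g f) := by
  have hG : IsTopologicalGroup G := topologicalGroup_of_lieGroup 𝓘(ℂ, E) ω
  obtain ⟨γ, hγ⟩ := exists_extension β
  intro g₀
  let e := extChartAt 𝓘(ℂ, E) g₀
  have hopen : IsOpen e.target := isOpen_extChartAt_target g₀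
  have hsymm : MDifferentiableOn 𝓘(ℂ, E) 𝓘(ℂ, E) e.symm e.target :=
    (contMDiffOn_extChartAt_symm (n := 1) g₀).mdifferentiableOn one_ne_zero
  obtain ⟨R, hR, hball⟩ := Metric.isOpen_iff.1 hopen _ (mem_extChartAt_target (I := 𝓘(ℂ, E)) g₀)
  let Φ : E → C(G, ℂ) := fun z => (leftTranslate (e.symm z) f).toContinuousMap
  have key : DifferentiableAt ℂ (fun z => γ (Φ z)) (e g₀) := by
    refine differentiableAt_apply γ Φ hR ?_ ?_
    · have h1 : ContinuousOn (fun p : E × G => e.symm p.1 * p.2)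
          (Metric.ball (e g₀) R ×ˢ Set.univ) := by
        refine ContinuousOn.mul ?_ continuousOn_snd
        exact (hsymm.continuousOn.mono hball).comp continuousOn_fst fun p hp => hp.1
      exact f.continuous.comp_continuousOn h1
    · intro x
      rw [← mdifferentiableOn_iff_differentiableOn]
      have h2 : MDifferentiable 𝓘(ℂ, E) 𝓘(ℂ, E) fun g : G => g * x :=
        (contMDiff_mul_right (I := 𝓘(ℂ, E)) (n := ω)).mdifferentiable (by simp)
      exact (f.mdifferentiable.comp h2).comp_mdifferentiableOn (hsymm.mono hball)
  have h3 : (fun g : G => β (leftTranslate g f)) =ᶠ[𝓝 g₀] (fun z => γ (Φ z)) ∘ e := by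
    filter_upwards [extChartAt_source_mem_nhds (I := 𝓘(ℂ, E)) g₀] with g hg
    simp only [Function.comp_apply, Φ, hγ]
    rw [e.left_inv hg]
  refine MDifferentiableAt.congr_of_eventuallyEq ?_ h3
  exact key.mdifferentiableAt.comp g₀ (mdifferentiableAt_extChartAt (mem_chart_source E g₀))

/-- The operator `f ↦ (g ↦ ⟨β, h ↦ f (g * h)⟩)` on `𝒪(G)`, i.e. `(id ⊗ β) ∘ Δ` for the
comultiplication `(Δ f) (g, h) = f (g * h)`. -/
def convolutionOperator (β : AnalyticFunctional E G) :
    HolomorphicFunctions E G →L[ℂ] HolomorphicFunctions E G where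
  toFun f := .mk (fun g => β (leftTranslate g f)) (mdifferentiable_apply_leftTranslate β f)
  map_add' f₁ f₂ := HolomorphicFunctions.ext fun g => by simp [leftTranslate_add]
  map_smul' c f := HolomorphicFunctions.ext fun g => by simp [leftTranslate_smul]
  cont := by
    have hG : IsTopologicalGroup G := topologicalGroup_of_lieGroup 𝓘(ℂ, E) ω
    have hL : LocallyCompactSpace G := Manifold.locallyCompact_of_finiteDimensional 𝓘(ℂ, E)
    rw [HolomorphicFunctions.isInducing_toContinuousMap.continuous_iff]
    let m : C(G × G, G) := ⟨fun p => p.1 * p.2, continuous_mul⟩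
    have h1 : Continuous fun f : HolomorphicFunctions E G =>
        ContinuousMap.curry (f.toContinuousMap.comp m) :=
      ContinuousMap.continuous_curry.comp
        (m.continuous_precomp.comp HolomorphicFunctions.toContinuousMap.continuous)
    have h2 : Continuous fun p : HolomorphicFunctions E G × G => leftTranslate p.2 p.1 := by
      rw [HolomorphicFunctions.isInducing_toContinuousMap.continuous_iff]
      exact ContinuousEval.continuous_eval.comp (h1.prodMap continuous_id)
    let F : C(HolomorphicFunctions E G × G, ℂ) :=
      ⟨fun p => β (leftTranslate p.2 p.1), (map_continuous β).comp h2⟩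
    exact F.curry.continuous

@[simp] theorem convolutionOperator_apply (β : AnalyticFunctional E G)
    (f : HolomorphicFunctions E G) (g : G) :
    convolutionOperator β f g = β (leftTranslate g f) := rfl

/-- Convolution: `⟨α * β, f⟩ = (α ⊗ β) (Δ f)`, where `(Δ f) (g, h) = f (g * h)`; that is, `β` is
applied to `f (g * h)` in the variable `h`, and `α` to the result in the variable `g`. -/
instance : Mul (AnalyticFunctional E G) where
  mul α β := ContinuousLinearMap.comp (α : StrongDual ℂ (HolomorphicFunctions E G))
    (convolutionOperator β)

theorem mul_apply (α β : AnalyticFunctional E G) (f : HolomorphicFunctions E G) :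
    (α * β) f = α (convolutionOperator β f) := rfl

theorem delta_mul_delta (g h : G) :
    (delta g * delta h : AnalyticFunctional E G) = delta (g * h) := by
  ext f
  simp [mul_apply]

instance : Ring (AnalyticFunctional E G) :=
  { (inferInstance : AddCommGroup (AnalyticFunctional E G)),
    (inferInstance : Mul (AnalyticFunctional E G)),
    (inferInstance : One (AnalyticFunctional E G)) with
    left_distrib := fun α β γ => by
      ext f
      rw [add_apply, mul_apply, mul_apply, mul_apply, ← map_add]
      exact congrArg α (HolomorphicFunctions.ext fun g => rfl)
    right_distrib := fun α β γ => rfl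
    zero_mul := fun α => rfl
    mul_zero := fun α => by
      ext f
      rw [mul_apply, zero_apply, ← map_zero α]
      exact congrArg α (HolomorphicFunctions.ext fun g => rfl)
    mul_assoc := fun α β γ => by
      ext f
      simp only [mul_apply]
      refine congrArg α (HolomorphicFunctions.ext fun g => ?_)
      simp only [convolutionOperator_apply, mul_apply]
      refine congrArg β (HolomorphicFunctions.ext fun h => ?_)
      simp only [convolutionOperator_apply, leftTranslate_apply, leftTranslate_mul]
    one_mul := fun α => by
      ext f
      rw [mul_apply, one_apply, convolutionOperator_apply, leftTranslate_one]
    mul_one := fun α => by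
      ext f
      rw [mul_apply]
      refine congrArg α (HolomorphicFunctions.ext fun g => ?_)
      rw [convolutionOperator_apply, one_apply, leftTranslate_apply, mul_one] }

instance : Algebra ℂ (AnalyticFunctional E G) :=
  Algebra.ofModule (fun c α β => rfl) fun c α β => by
    ext f
    rw [mul_apply, smul_apply, mul_apply, ← smul_eq_mul, ← map_smul]
    exact congrArg α (HolomorphicFunctions.ext fun g => rfl)

end Convolution

end AnalyticFunctional

/-! ### Complete locally convex algebras and bimodules -/

/-- Complete Hausdorff locally convex spaces over `ℂ`. -/
class IsCompleteLocallyConvex (X : Type*) [AddCommGroup X] [Module ℂ X] [UniformSpace X] : Prop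
    extends IsUniformAddGroup X, ContinuousSMul ℂ X, LocallyConvexSpace ℝ X, T2Space X,
      CompleteSpace X

/-- Unital `⊗̂`-algebras: complete Hausdorff locally convex algebras over `ℂ` with jointly continuous
multiplication. -/
class IsTensorHatAlgebra (A : Type*) [Ring A] [Algebra ℂ A] [UniformSpace A] : Prop
    extends IsCompleteLocallyConvex A, ContinuousMul A

/-- `A`-`⊗̂`-bimodules: complete Hausdorff locally convex spaces with commuting, jointly continuous,
`ℂ`-bilinear unital left and right actions of `A` (a right action is an action of `Aᵐᵒᵖ`). -/
class IsTensorHatBimodule (A : Type*) [Ring A] [Algebra ℂ A] [UniformSpace A]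
    (X : Type*) [AddCommGroup X] [Module ℂ X] [UniformSpace X] [Module A X] [Module Aᵐᵒᵖ X] : Prop
    extends IsCompleteLocallyConvex X where
  isScalarTower_left : IsScalarTower ℂ A X
  isScalarTower_right : IsScalarTower ℂ Aᵐᵒᵖ X
  smulCommClass : SMulCommClass A Aᵐᵒᵖ X
  continuousSMul_left : ContinuousSMul A X
  continuousSMul_right : ContinuousSMul Aᵐᵒᵖ X

attribute [instance] IsTensorHatBimodule.isScalarTower_left IsTensorHatBimodule.isScalarTower_right
  IsTensorHatBimodule.smulCommClass IsTensorHatBimodule.continuousSMul_left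
  IsTensorHatBimodule.continuousSMul_right

/-- Morphisms of `A`-`⊗̂`-bimodules are the continuous linear maps that satisfy this condition. -/
structure IsBimoduleMorphism (A : Type*) [Ring A]
    {X : Type*} [AddCommGroup X] [Module ℂ X] [TopologicalSpace X] [Module A X] [Module Aᵐᵒᵖ X]
    {Y : Type*} [AddCommGroup Y] [Module ℂ Y] [TopologicalSpace Y] [Module A Y] [Module Aᵐᵒᵖ Y]
    (φ : X →L[ℂ] Y) : Prop where
  map_smul_left : ∀ (a : A) (x : X), φ (a • x) = a • φ x
  map_smul_right : ∀ (a : A) (x : X), φ (MulOpposite.op a • x) = MulOpposite.op a • φ x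

/-- An `A`-`⊗̂`-bimodule `P` is projective if every morphism `φ : P → Y` lifts along every admissible
epimorphism `σ : X → Y` of `A`-`⊗̂`-bimodules, i.e. along every morphism that has a right inverse
continuous linear map `s`. (Taking `φ` to be the identity of `P`, admissible epimorphisms onto `P`
have a right inverse morphism.) The test bimodules `X`, `Y` range over the universe `w`. -/
def IsProjectiveBimodule (A : Type u) [Ring A] [Algebra ℂ A] [UniformSpace A]
    (P : Type v) [AddCommGroup P] [Module ℂ P] [UniformSpace P] [Module A P] [Module Aᵐᵒᵖ P] :
    Prop :=
  IsTensorHatBimodule A P ∧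
  ∀ (X : Type w) [AddCommGroup X] [Module ℂ X] [UniformSpace X] [Module A X] [Module Aᵐᵒᵖ X]
    [IsTensorHatBimodule A X]
    (Y : Type w) [AddCommGroup Y] [Module ℂ Y] [UniformSpace Y] [Module A Y] [Module Aᵐᵒᵖ Y]
    [IsTensorHatBimodule A Y]
    (σ : X →L[ℂ] Y) (s : Y →L[ℂ] X) (φ : P →L[ℂ] Y),
    IsBimoduleMorphism A σ → σ.comp s = ContinuousLinearMap.id ℂ Y → IsBimoduleMorphism A φ →
      ∃ τ : P →L[ℂ] X, IsBimoduleMorphism A τ ∧ σ.comp τ = φ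

/-- A unital `⊗̂`-algebra is homologically trivial (contractible) if it is projective as a
`⊗̂`-bimodule over itself. -/
def IsHomologicallyTrivial (A : Type u) [Ring A] [Algebra ℂ A] [UniformSpace A] : Prop :=
  IsTensorHatAlgebra A ∧ IsProjectiveBimodule.{w, u, u} A A

/-! ### Linearly complex reductive groups -/

/-- `η : K → G` exhibits the complex Lie group `G` as the universal complexification of the real Lie
group `K`: `η` is a homomorphism of real Lie groups, and every homomorphism of real Lie groups `α`
from `K` to a complex Lie group `H` is `α' ∘ η` for a unique holomorphic homomorphism
`α' : G → H`. -/
structure IsUniversalComplexification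
    (F : Type u) [NormedAddCommGroup F] [NormedSpace ℝ F]
    {K : Type u} [TopologicalSpace K] [ChartedSpace F K] [Group K]
    (E : Type u) [NormedAddCommGroup E] [NormedSpace ℂ E]
    {G : Type u} [TopologicalSpace G] [ChartedSpace E G] [Group G]
    (η : K →* G) : Prop where
  contMDiff : ContMDiff 𝓘(ℝ, F) 𝓘(ℝ, E) ∞ η
  existsUnique : ∀ (E' : Type u) [NormedAddCommGroup E'] [NormedSpace ℂ E']
    [FiniteDimensional ℂ E']
    (H : Type u) [TopologicalSpace H] [ChartedSpace E' H] [Group H] [LieGroup 𝓘(ℂ, E') ω H]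
    [T2Space H] (α : K →* H), ContMDiff 𝓘(ℝ, F) 𝓘(ℝ, E') ∞ α →
      ∃! α' : G →* H, MDifferentiable 𝓘(ℂ, E) 𝓘(ℂ, E') α' ∧ α'.comp η = α

/-- A complex Lie group `G` (modelled on `E`) is linearly complex reductive if it is the universal
complexification of some compact real Lie group `K`. -/
def IsLinearlyComplexReductive (E : Type u) [NormedAddCommGroup E] [NormedSpace ℂ E]
    (G : Type u) [TopologicalSpace G] [ChartedSpace E G] [Group G] : Prop :=
  ∃ (F : Type u) (_ : NormedAddCommGroup F) (_ : NormedSpace ℝ F) (_ : FiniteDimensional ℝ F)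
    (K : Type u) (_ : TopologicalSpace K) (_ : ChartedSpace F K) (_ : Group K)
    (_ : LieGroup 𝓘(ℝ, F) ∞ K) (_ : T2Space K) (_ : CompactSpace K) (η : K →* G),
    IsUniversalComplexification F E η

end

/-!
# The algebra of analytic functionals on a linearly complex reductive group is contractible

Let `η : K → G` be the universal complexification of a compact Lie group. A bimodule morphism from
`A = 𝒜(G)` to `X` is determined by the image `x` of `1`, which is central (`a • x = x • a` for all
`a`), and every central element `x` gives the morphism `a ↦ a • x`. To lift `φ : A → Y` along
`σ : X → Y`, start from any preimage `x₀` of `φ 1` and average: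
`x = ∫ δ_{η k} • x₀ • δ_{(η k)⁻¹} dk` over `K`. Then `σ x = φ 1`, and `x` commutes with `δ_g` for
every `g` in the image of `K`. It remains to see that `x` is central
(`IsUniversalComplexification.smul_eq_op_smul`). For a continuous functional `ℓ` on `X` the function
`g ↦ ℓ (δ_g • x • δ_{g⁻¹})` is holomorphic and invariant under right translations by `K`, so it is
constant by the "unitarian trick" below; hence `x` commutes with all `δ_g`, and these span a dense
subspace of `A` (`AnalyticFunctional.mem_closure_span_delta`).

**The unitarian trick** (`IsUniversalComplexification.apply_eq_apply_one`): a holomorphic function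
on `G` that is invariant under `K` is constant. The only information about `G` is its universal
property, so the argument has to produce complex Lie groups to which it can be applied. Let `R` be
the space of holomorphic functions that are locally constant along the cosets of `K`, and
`𝔫 ⊆ T₁ G` the common kernel of their differentials at `1`. A function belongs to `R` if and only if
the differentials of its left translates vanish on `𝔫`. The subspace `𝔫` is stable under `Ad K`,
hence under `Ad G` (`IsUniversalComplexification.adjointMap_mem`): averaging over `K` a projection
onto `𝔫` gives one that commutes with `Ad K`, and by uniqueness of extensions from `K`, applied to
the adjoint representation and a conjugate of it, it commutes with `Ad G`. So `R` is stable under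
right translations too, and the subgroup `N` of the `n` with `f (x * n) = f x` for all `f ∈ R` is
normal. Finitely many members of `R` form coordinates transverse to the cosets of `N`
(`exists_transverseCoordinates`), so `G ⧸ N` is a complex Lie group
(`TransverseCoordinates.lieGroup`). The map `K → G ⧸ N` is locally constant, with a finite image;
by the universal property the image of `G` is no larger
(`IsUniversalComplexification.exists_eq_of_isLocallyConstant`). Thus `N` has finite index and is
open, the members of `R` are locally constant, and a `K`-invariant one is constant because `K` meets
every component of `G`.

**Topology.** The same universal property shows that `G` has finitely many components,
so `G` is `σ`-compact and `𝒪(G)` is metrizable; its strong dual `A` is therefore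
complete. Convolution is jointly continuous because a bounded set `B ⊆ 𝒪(G)` admits a locally
bounded weight `w` with `‖f (g * h)‖ ≤ w g * w h` for all `f ∈ B`. The matrix coefficient above is
holomorphic because, by Cauchy estimates, `δ_g` has a first-order expansion in local coordinates
whose remainder is quadratic uniformly on bounded sets
(`AnalyticFunctional.exists_derivative_delta`). The average over `K` exists because the closed
absolutely convex hull of a compact set in a complete locally convex space is compact
(`exists_forall_eq_integral`).
-/

noncomputable section

/-! ### Holomorphic functions of several variables -/

section SeveralVariables

variable {E : Type*} [NormedAddCommGroup E] [NormedSpace ℂ E]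

/-- Cauchy estimate for the first derivative. -/
theorem norm_fderiv_le_of_norm_le_ball {F : Type*} [NormedAddCommGroup F] [NormedSpace ℂ F]
    {u : E → F} {c : E} {r C : ℝ} (hr : 0 < r) (hu : DifferentiableOn ℂ u (Metric.ball c r))
    (hC : ∀ z ∈ Metric.ball c r, ‖u z‖ ≤ C) : ‖fderiv ℂ u c‖ ≤ 2 * C / r := by
  refine Complex.norm_fderiv_le_div_of_mapsTo_ball hu (fun w hw => ?_) hr
  rw [mem_closedBall_iff_norm]
  linarith [norm_sub_le (u w) (u c), hC w hw, hC c (Metric.mem_ball_self hr)]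

/-- Second-order Cauchy estimate for maps into a normed space. -/
theorem norm_sub_sub_fderiv_le_of_norm_le_ball {F : Type*} [NormedAddCommGroup F] [NormedSpace ℂ F]
    {u : E → F} {c : E} {r C : ℝ} (hr : 0 < r)
    (hu : DifferentiableOn ℂ u (Metric.ball c r)) (hC : ∀ z ∈ Metric.ball c r, ‖u z‖ ≤ C)
    {z : E} (hz : z ∈ Metric.ball c r) :
    ‖u z - u c - fderiv ℂ u c (z - c)‖ ≤ 4 * C * (‖z - c‖ / r) ^ 2 := by
  have hc : c ∈ Metric.ball c r := Metric.mem_ball_self hr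
  have hd := norm_fderiv_le_of_norm_le_ball hr hu hC
  have hda : HasFDerivAt u (fderiv ℂ u c) c :=
    (hu.differentiableAt (Metric.isOpen_ball.mem_nhds hc)).hasFDerivAt
  let v : E → F := fun w => u w - fderiv ℂ u c (w - c)
  have key := Complex.dist_le_mul_div_pow_of_mapsTo_ball_of_isLittleO (f := v) (c := c) (R₁ := r)
    (R₂ := 4 * C) (n := 1) (z := z) ?_ ?_ ?_ hz
  · simpa [v, dist_eq_norm_sub, sub_right_comm] using key
  · exact hu.sub (by fun_prop)
  · intro w hw
    rw [mem_closedBall_iff_norm]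
    have h2 : ‖fderiv ℂ u c (w - c)‖ ≤ 2 * C := by
      refine ((fderiv ℂ u c).le_opNorm _).trans ?_
      have h3 : ‖w - c‖ ≤ r := (mem_ball_iff_norm.1 hw).le
      calc _ ≤ 2 * C / r * r := mul_le_mul hd h3 (norm_nonneg _) ((norm_nonneg _).trans hd)
        _ = 2 * C := by field_simp
    have h4 : v w - v c = (u w - u c) - fderiv ℂ u c (w - c) := by simp [v]; abel
    rw [h4]
    linarith [norm_sub_le (u w - u c) (fderiv ℂ u c (w - c)), norm_sub_le (u w) (u c), hC w hw,
      hC c hc]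
  · have := hda.isLittleO
    simp only [pow_one]
    refine (this.norm_right).congr_left fun w => ?_
    simp [v]; abel

/-- A uniform limit of holomorphic maps is holomorphic. -/
theorem differentiableAt_of_tendstoUniformlyOn_ball {F : Type*} [NormedAddCommGroup F]
    [NormedSpace ℂ F] [CompleteSpace F] {f : ℕ → E → F} {g : E → F} {c : E} {R : ℝ} (hR : 0 < R)
    (hf : ∀ n, DifferentiableOn ℂ (f n) (Metric.ball c R))
    (h : TendstoUniformlyOn f g Filter.atTop (Metric.ball c R)) : DifferentiableAt ℂ g c := by
  have hs : ∀ z ∈ Metric.ball c (R / 2), Metric.ball z (R / 2) ⊆ Metric.ball c R := by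
    intro z hz
    refine Metric.ball_subset_ball' ?_
    have := Metric.mem_ball.1 hz
    linarith
  have hs0 : Metric.ball c (R / 2) ⊆ Metric.ball c R := Metric.ball_subset_ball (by linarith)
  have hd : ∀ n, ∀ z ∈ Metric.ball c (R / 2), DifferentiableAt ℂ (f n) z := fun n z hz =>
    (hf n).differentiableAt (Metric.isOpen_ball.mem_nhds (hs0 hz))
  have hC : UniformCauchySeqOn (fun n => fderiv ℂ (f n)) Filter.atTop (Metric.ball c (R / 2)) := by
    rw [Metric.uniformCauchySeqOn_iff]
    intro ε hε
    obtain ⟨N, hN⟩ := Metric.uniformCauchySeqOn_iff.1 h.uniformCauchySeqOn (ε * R / 8)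
      (by positivity)
    refine ⟨N, fun m hm n hn z hz => ?_⟩
    have h1 := norm_fderiv_le_of_norm_le_ball (u := f m - f n) (c := z) (r := R / 2)
      (C := ε * R / 8) (by linarith) (((hf m).sub (hf n)).mono (hs z hz)) fun w hw => by
        have := hN m hm n hn w (hs z hz hw)
        rw [dist_eq_norm_sub] at this
        exact this.le
    rw [fderiv_sub (hd m z hz) (hd n z hz)] at h1
    rw [dist_eq_norm_sub]
    refine h1.trans_lt ?_
    have : 2 * (ε * R / 8) / (R / 2) = ε / 2 := by field_simp; norm_num
    rw [this]; linarith
  have hlim : ∀ z ∈ Metric.ball c (R / 2), ∃ l, Filter.Tendsto (fun n => fderiv ℂ (f n) z)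
      Filter.atTop (𝓝 l) := fun z hz => cauchySeq_tendsto_of_complete (hC.cauchySeq hz)
  choose! g' hg' using hlim
  exact (hasFDerivAt_of_tendstoUniformlyOn Metric.isOpen_ball
    (hC.tendstoUniformlyOn_of_tendsto hg') (fun n z hz => (hd n z hz).hasFDerivAt)
    (fun z hz => h.tendsto_at (hs0 hz)) (Metric.mem_ball_self (by linarith))).differentiableAt

/-- Directional derivatives of a bounded holomorphic map are holomorphic. -/
theorem differentiableAt_fderiv_apply {F : Type*} [NormedAddCommGroup F]
    [NormedSpace ℂ F] [CompleteSpace F] {u : E → F} {c : E} {R C : ℝ} (hR : 0 < R)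
    (hu : DifferentiableOn ℂ u (Metric.ball c R)) (hC : ∀ z ∈ Metric.ball c R, ‖u z‖ ≤ C) (w : E) :
    DifferentiableAt ℂ (fun z => fderiv ℂ u z w) c := by
  obtain ⟨N, hN⟩ := exists_nat_gt (2 * ‖w‖ / R)
  have hN0 : (0 : ℝ) < N := lt_of_le_of_lt (by positivity) hN
  let t : ℕ → ℂ := fun n => ((n + N : ℕ) : ℂ)⁻¹
  have ht0 : ∀ n, (0 : ℝ) < ((n + N : ℕ) : ℝ) := fun n => by push_cast; positivity
  have ht : ∀ n, t n ≠ 0 := fun n => inv_ne_zero (by exact_mod_cast (ht0 n).ne')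
  have htn : ∀ n, ‖t n‖ = (((n + N : ℕ) : ℝ))⁻¹ := fun n => by
    rw [norm_inv, Complex.norm_natCast]
  have htw : ∀ n, ‖t n • w‖ < R / 2 := by
    intro n
    rw [norm_smul, htn, inv_mul_lt_iff₀ (ht0 n)]
    rw [div_lt_iff₀ hR] at hN
    push_cast
    nlinarith [Nat.cast_nonneg (α := ℝ) n]
  have hball : ∀ z ∈ Metric.ball c (R / 2), ∀ n, z + t n • w ∈ Metric.ball c R := by
    intro z hz n
    rw [mem_ball_iff_norm] at hz ⊢
    have := norm_add_le (z - c) (t n • w)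
    rw [show z + t n • w - c = (z - c) + t n • w by abel]
    linarith [htw n]
  have hs0 : Metric.ball c (R / 2) ⊆ Metric.ball c R := Metric.ball_subset_ball (by linarith)
  refine differentiableAt_of_tendstoUniformlyOn_ball (R := R / 2) (by linarith)
    (f := fun n z => (t n)⁻¹ • (u (z + t n • w) - u z)) (fun n => ?_) ?_
  · refine DifferentiableOn.const_smul (DifferentiableOn.sub ?_ (hu.mono hs0)) _
    exact hu.comp (by fun_prop) fun z hz => hball z hz n
  · rw [Metric.tendstoUniformlyOn_iff]
    intro ε hε
    have hlim : Filter.Tendsto (fun n : ℕ => 16 * C * ‖w‖ ^ 2 / R ^ 2 * ‖t n‖) Filter.atTop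
        (𝓝 0) := by
      have h1 : Filter.Tendsto (fun n : ℕ => ((n + N : ℕ) : ℝ)⁻¹) Filter.atTop (𝓝 0) :=
        (tendsto_inv_atTop_nhds_zero_nat (𝕜 := ℝ)).comp (Filter.tendsto_add_atTop_nat N)
      simpa [htn] using h1.const_mul (16 * C * ‖w‖ ^ 2 / R ^ 2)
    filter_upwards [hlim.eventually_lt_const hε] with n hn z hz
    refine lt_of_le_of_lt ?_ hn
    have hsub : Metric.ball z (R / 2) ⊆ Metric.ball c R := by
      refine Metric.ball_subset_ball' ?_
      have := Metric.mem_ball.1 hz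
      linarith
    have h2 := norm_sub_sub_fderiv_le_of_norm_le_ball (u := u) (c := z) (r := R / 2) (C := C)
      (by linarith) (hu.mono hsub) (fun y hy => hC y (hsub hy)) (z := z + t n • w)
      (by simpa [mem_ball_iff_norm] using htw n)
    have e : fderiv ℂ u z w - (t n)⁻¹ • (u (z + t n • w) - u z)
        = -((t n)⁻¹ • (u (z + t n • w) - u z - fderiv ℂ u z (z + t n • w - z))) := by
      rw [add_sub_cancel_left, map_smul, smul_sub (t n)⁻¹ _ (t n • _), smul_smul,
        inv_mul_cancel₀ (ht n), one_smul]
      abel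
    rw [dist_eq_norm_sub, e, norm_neg, norm_smul, norm_inv]
    have hp : 0 < ‖t n‖ := norm_pos_iff.2 (ht n)
    rw [inv_mul_le_iff₀ hp]
    refine h2.trans (le_of_eq ?_)
    rw [add_sub_cancel_left, norm_smul]
    field_simp
    ring

/-- The derivative of a bounded holomorphic map is holomorphic. -/
theorem differentiableAt_fderiv_of_norm_le_ball [FiniteDimensional ℂ E] {F : Type*}
    [NormedAddCommGroup F] [NormedSpace ℂ F] [CompleteSpace F] {u : E → F} {c : E} {R C : ℝ}
    (hR : 0 < R) (hu : DifferentiableOn ℂ u (Metric.ball c R))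
    (hC : ∀ z ∈ Metric.ball c R, ‖u z‖ ≤ C) : DifferentiableAt ℂ (fderiv ℂ u) c := by
  let b := Module.finBasis ℂ E
  have e : fderiv ℂ u = fun z => ∑ i, (LinearMap.toContinuousLinearMap (b.coord i)).smulRight
      (fderiv ℂ u z (b i)) := by
    ext z y
    conv_lhs => rw [← b.sum_repr y]
    simp only [map_sum, map_smul, sum_apply, ContinuousLinearMap.smulRight_apply,
      LinearMap.coe_toContinuousLinearMap', Module.Basis.coord_apply]
  rw [e]
  refine DifferentiableAt.fun_sum fun i _ => ?_
  exact (ContinuousLinearMap.smulRightL ℂ E F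
    (LinearMap.toContinuousLinearMap (b.coord i))).differentiableAt.comp c
      (differentiableAt_fderiv_apply hR hu hC (b i))

end SeveralVariables

section Analytic

variable {E : Type u} [NormedAddCommGroup E] [NormedSpace ℂ E] [FiniteDimensional ℂ E]

/-- Cauchy estimates for all derivatives of a holomorphic map. -/
theorem norm_iteratedFDeriv_le_of_norm_le_ball (n : ℕ) : ∀ {F : Type u} [NormedAddCommGroup F]
    [NormedSpace ℂ F] [CompleteSpace F] {u : E → F} {c : E} {δ C : ℝ}, 0 < δ →
    DifferentiableOn ℂ u (Metric.ball c ((n + 1) * δ)) →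
    (∀ z ∈ Metric.ball c ((n + 1) * δ), ‖u z‖ ≤ C) →
      ContDiffAt ℂ n u c ∧ ‖iteratedFDeriv ℂ n u c‖ ≤ C * (2 / δ) ^ n := by
  induction n with
  | zero =>
    intro F _ _ _ u c δ C hδ hu hC
    simp only [Nat.cast_zero, zero_add, one_mul] at hu hC
    refine ⟨?_, by simpa using hC c (Metric.mem_ball_self hδ)⟩
    refine contDiffAt_zero.2 ⟨_, Metric.ball_mem_nhds c hδ, hu.continuousOn⟩
  | succ n ih =>
    intro F _ _ _ u c δ C hδ hu hC
    have hpos : 0 < ((n : ℝ) + 1) * δ := by positivity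
    have hsub : ∀ z ∈ Metric.ball c ((n + 1) * δ),
        Metric.ball z δ ⊆ Metric.ball c (((n + 1 : ℕ) + 1) * δ) := by
      intro z hz
      refine Metric.ball_subset_ball' ?_
      have := Metric.mem_ball.1 hz
      push_cast
      linarith
    have h1 : DifferentiableOn ℂ (fderiv ℂ u) (Metric.ball c ((n + 1) * δ)) := fun z hz =>
      (differentiableAt_fderiv_of_norm_le_ball hδ (hu.mono (hsub z hz))
        fun y hy => hC y (hsub z hz hy)).differentiableWithinAt
    have h2 : ∀ z ∈ Metric.ball c ((n + 1) * δ), ‖fderiv ℂ u z‖ ≤ 2 * C / δ := fun z hz =>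
      norm_fderiv_le_of_norm_le_ball hδ (hu.mono (hsub z hz)) fun y hy => hC y (hsub z hz hy)
    obtain ⟨h3, h4⟩ := ih hδ h1 h2
    constructor
    · have := contDiffAt_succ_iff_hasFDerivAt (𝕜 := ℂ) (n := n) (f := u) (x := c)
      push_cast
      refine this.2 ⟨fderiv ℂ u, ⟨_, Metric.ball_mem_nhds c hpos, fun z hz => ?_⟩, h3⟩
      exact (hu.differentiableAt (Metric.isOpen_ball.mem_nhds
        (hsub z hz (Metric.mem_ball_self hδ)))).hasFDerivAt
    · rw [← norm_iteratedFDeriv_fderiv]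
      refine h4.trans (le_of_eq ?_)
      rw [pow_succ]
      ring

/-- A holomorphic map on an open subset of a finite-dimensional space is analytic. -/
theorem analyticAt_of_differentiableOn_ball {F : Type u} [NormedAddCommGroup F]
    [NormedSpace ℂ F] [CompleteSpace F] {u : E → F} {c : E} {R C : ℝ} (hR : 0 < R)
    (hu : DifferentiableOn ℂ u (Metric.ball c R)) (hC : ∀ z ∈ Metric.ball c R, ‖u z‖ ≤ C) :
    AnalyticAt ℂ u c := by
  have hC0 : 0 ≤ C := (norm_nonneg _).trans (hC c (Metric.mem_ball_self hR))
  -- On concentric balls of radius `R / (n + 1)` the `n`-th Cauchy estimate gives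
  -- `‖Dⁿ u‖ / n! ≤ C (2 (n + 1) / R) ^ n / n! ≤ C e (2 e / R) ^ n`.
  have hbound : ∀ n : ℕ, ‖iteratedFDeriv ℂ n u c‖ ≤ C * (2 * (n + 1) / R) ^ n := by
    intro n
    have hn : ((n : ℝ) + 1) * (R / (n + 1)) = R := by field_simp
    have := (norm_iteratedFDeriv_le_of_norm_le_ball n (u := u) (c := c) (δ := R / (n + 1)) (C := C)
      (by positivity) (by rwa [hn]) (by rwa [hn])).2
    rwa [show (2 : ℝ) / (R / (n + 1)) = 2 * (n + 1) / R by field_simp] at this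
  have hsmooth : ∀ n : ℕ, ContDiffOn ℂ n u (Metric.ball c R) := by
    intro n z hz
    obtain ⟨r, hr, hrs⟩ := Metric.isOpen_iff.1 Metric.isOpen_ball z hz
    have hn : ((n : ℝ) + 1) * (r / (n + 1)) = r := by field_simp
    exact (norm_iteratedFDeriv_le_of_norm_le_ball n (u := u) (c := z) (δ := r / (n + 1)) (C := C)
      (by positivity) (by rw [hn]; exact hu.mono hrs)
      (by rw [hn]; exact fun y hy => hC y (hrs hy))).1.contDiffWithinAt
  let p : FormalMultilinearSeries ℂ E F := fun n => ((n.factorial : ℂ))⁻¹ • iteratedFDeriv ℂ n u c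
  let ρ : NNReal := ⟨R / (2 * Real.exp 1), by positivity⟩
  have hρ : (ρ : ℝ) = R / (2 * Real.exp 1) := rfl
  have hρ0 : 0 < ρ := show (0 : ℝ) < R / (2 * Real.exp 1) by positivity
  have hρR : (ρ : ℝ) < R := by
    rw [hρ]
    refine div_lt_self hR ?_
    linarith [Real.add_one_le_exp 1]
  refine HasFPowerSeriesOnBall.analyticAt (p := p) (r := ρ) ⟨?_, by exact_mod_cast hρ0, ?_⟩
  · refine p.le_radius_of_bound (C * Real.exp 1) fun n => ?_
    simp only [p]
    rw [norm_smul, norm_inv, Complex.norm_natCast, hρ]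
    have h1 : ((n : ℝ) + 1) ^ n / n.factorial ≤ Real.exp (n + 1) :=
      Real.pow_div_factorial_le_exp _ (by positivity) n
    have h2 : Real.exp ((n : ℝ) + 1) = Real.exp 1 * Real.exp 1 ^ n := by
      rw [Real.exp_add, mul_comm, ← Real.exp_nat_mul, mul_one]
    rw [h2] at h1
    calc _ ≤ ((n.factorial : ℝ))⁻¹ * (C * (2 * (n + 1) / R) ^ n) * (R / (2 * Real.exp 1)) ^ n := by
          gcongr
          exact hbound n
      _ = C * (((n : ℝ) + 1) ^ n / n.factorial) / Real.exp 1 ^ n := by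
          rw [div_pow, div_pow, mul_pow, mul_pow]
          field_simp
      _ ≤ C * (Real.exp 1 * Real.exp 1 ^ n) / Real.exp 1 ^ n := by gcongr
      _ = C * Real.exp 1 := by field_simp
  · intro y hy
    have hy' : ‖y‖ < ρ := by simpa [edist_zero_right, enorm_eq_nnnorm] using hy
    let L : ℂ →L[ℂ] E := (1 : ℂ →L[ℂ] ℂ).smulRight y
    have hL : ∀ z, L z = z • y := fun z => by simp [L]
    let g : ℂ → F := (fun x => u (c + x)) ∘ L
    have hmaps : ∀ z ∈ Metric.ball (0 : ℂ) (R / ρ), c + L z ∈ Metric.ball c R := by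
      intro z hz
      rw [mem_ball_zero_iff, lt_div_iff₀ (by exact_mod_cast hρ0)] at hz
      rw [mem_ball_iff_norm, add_sub_cancel_left, hL, norm_smul]
      exact (mul_le_mul_of_nonneg_left hy'.le (norm_nonneg z)).trans_lt hz
    have hg : DifferentiableOn ℂ g (Metric.ball 0 (R / ρ)) :=
      hu.comp (by fun_prop) hmaps
    have h1 : (1 : ℂ) ∈ Metric.ball (0 : ℂ) (R / ρ) := by
      rw [mem_ball_zero_iff, norm_one, one_lt_div (by exact_mod_cast hρ0)]
      exact hρR
    have hsum := Complex.hasSum_taylorSeries_on_ball hg h1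
    have hgc : g 1 = u (c + y) := by simp [g, hL]
    rw [hgc] at hsum
    have hopen : IsOpen ((fun x => c + x) ⁻¹' Metric.ball c R) :=
      Metric.isOpen_ball.preimage (by fun_prop)
    have hterm : ∀ n, iteratedDeriv n g 0 = iteratedFDeriv ℂ n u c fun _ => y := by
      intro n
      have hs : ContDiffOn ℂ n (fun x => u (c + x)) ((fun x => c + x) ⁻¹' Metric.ball c R) :=
        (hsmooth n).comp (by fun_prop) fun x hx => hx
      have h0 : L 0 ∈ (fun x => c + x) ⁻¹' Metric.ball c R := by simpa using hR
      have h2 := L.iteratedFDerivWithin_comp_right hs hopen.uniqueDiffOn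
        (hopen.preimage L.continuous).uniqueDiffOn h0 le_rfl
      rw [iteratedFDerivWithin_of_isOpen n (hopen.preimage L.continuous) h0,
        iteratedFDerivWithin_of_isOpen n hopen h0, iteratedFDeriv_comp_add_left] at h2
      rw [iteratedDeriv_eq_iteratedFDeriv]
      change iteratedFDeriv ℂ n ((fun x => u (c + x)) ∘ L) 0 (fun _ => 1) = _
      rw [h2]
      simp [hL]
    refine hsum.congr_fun fun n => ?_
    simp [p, hterm]

/-- A map that is holomorphic near a point of a finite-dimensional space is analytic there. -/
theorem analyticAt_of_eventually_differentiableAt {F : Type u} [NormedAddCommGroup F]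
    [NormedSpace ℂ F] [CompleteSpace F] {u : E → F} {c : E}
    (hu : ∀ᶠ z in 𝓝 c, DifferentiableAt ℂ u z) : AnalyticAt ℂ u c := by
  have h1 : ∀ᶠ z in 𝓝 c, ‖u z‖ < ‖u c‖ + 1 :=
    hu.self_of_nhds.continuousAt.norm.eventually_lt_const (by linarith)
  obtain ⟨R, hR, hs⟩ := Metric.eventually_nhds_iff_ball.1 (hu.and h1)
  exact analyticAt_of_differentiableOn_ball hR (fun z hz => (hs z hz).1.differentiableWithinAt)
    fun z hz => (hs z hz).2.le

/-- A holomorphic map from a complex manifold to a normed space is analytic. -/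
theorem MDifferentiable.contMDiff_omega {M : Type*} [TopologicalSpace M] [ChartedSpace E M]
    [IsManifold 𝓘(ℂ, E) ω M] {F : Type u} [NormedAddCommGroup F] [NormedSpace ℂ F]
    [CompleteSpace F] {f : M → F} (hf : MDifferentiable 𝓘(ℂ, E) 𝓘(ℂ, F) f) :
    ContMDiff 𝓘(ℂ, E) 𝓘(ℂ, F) ω f := by
  intro x
  rw [contMDiffAt_iff]
  refine ⟨hf.continuous.continuousAt, ?_⟩
  have h1 : ∀ᶠ z in 𝓝 (extChartAt 𝓘(ℂ, E) x x),
      DifferentiableAt ℂ (f ∘ (extChartAt 𝓘(ℂ, E) x).symm) z := by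
    filter_upwards [(isOpen_extChartAt_target (I := 𝓘(ℂ, E)) x).mem_nhds
      (mem_extChartAt_target (I := 𝓘(ℂ, E)) x)] with z hz
    have hsymm : MDifferentiableOn 𝓘(ℂ, E) 𝓘(ℂ, E) (extChartAt 𝓘(ℂ, E) x).symm
        (extChartAt 𝓘(ℂ, E) x).target :=
      (contMDiffOn_extChartAt_symm (n := ω) x).mdifferentiableOn (by simp)
    have h2 := hf.comp_mdifferentiableOn hsymm
    rw [mdifferentiableOn_iff_differentiableOn] at h2
    exact h2.differentiableAt ((isOpen_extChartAt_target (I := 𝓘(ℂ, E)) x).mem_nhds hz)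
  exact (analyticAt_of_eventually_differentiableAt h1).contDiffAt.contDiffWithinAt

end Analytic

/-! ### Universal complexifications -/

section LocallyConstant

theorem IsLocallyConstant.contMDiff {𝕜 : Type*} [NontriviallyNormedField 𝕜]
    {E : Type*} [NormedAddCommGroup E] [NormedSpace 𝕜 E] {H : Type*} [TopologicalSpace H]
    {I : ModelWithCorners 𝕜 E H} {M : Type*} [TopologicalSpace M] [ChartedSpace H M]
    {E' : Type*} [NormedAddCommGroup E'] [NormedSpace 𝕜 E'] {H' : Type*} [TopologicalSpace H']
    {I' : ModelWithCorners 𝕜 E' H'} {M' : Type*} [TopologicalSpace M'] [ChartedSpace H' M']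
    {n : ℕ∞ω} {f : M → M'} (hf : IsLocallyConstant f) : ContMDiff I I' n f := fun x =>
  contMDiffAt_const.congr_of_eventuallyEq (hf.eventually_eq x)

/-- A homomorphism of topological groups that is constant near the identity is locally constant. -/
theorem MonoidHom.isLocallyConstant_of_eventually_eq_one {G H : Type*} [Group G]
    [TopologicalSpace G] [IsTopologicalGroup G] [Group H] (f : G →* H)
    (h : ∀ᶠ x in 𝓝 (1 : G), f x = 1) : IsLocallyConstant f := by
  rw [IsLocallyConstant.iff_eventually_eq]
  intro x
  have h1 : Filter.Tendsto (fun y => x⁻¹ * y) (𝓝 x) (𝓝 1) := by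
    have : Continuous fun y : G => x⁻¹ * y := by fun_prop
    simpa using this.tendsto x
  filter_upwards [h1.eventually h] with y hy
  rw [map_mul, map_inv, inv_mul_eq_one] at hy
  exact hy.symm

attribute [local instance] ChartedSpace.ofDiscreteTopology in
/-- A discrete group is a complex Lie group of dimension zero. -/
theorem lieGroup_of_discreteTopology (S : Type u) [Group S] [TopologicalSpace S]
    [DiscreteTopology S] : LieGroup 𝓘(ℂ, PUnit.{u + 1}) ω S where
  toIsManifold := IsManifold.of_discreteTopology ω
  contMDiff_mul := by
    refine IsLocallyConstant.contMDiff ?_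
    exact IsLocallyConstant.of_discrete _
  contMDiff_inv := contMDiff_of_discreteTopology

/-- A holomorphic map between complex manifolds is smooth as a map of real manifolds. -/
theorem ContMDiff.restrictScalars_real {E : Type*} [NormedAddCommGroup E] [NormedSpace ℂ E]
    {M : Type*} [TopologicalSpace M] [ChartedSpace E M]
    {E' : Type*} [NormedAddCommGroup E'] [NormedSpace ℂ E']
    {M' : Type*} [TopologicalSpace M'] [ChartedSpace E' M'] {f : M → M'}
    (hf : ContMDiff 𝓘(ℂ, E) 𝓘(ℂ, E') ω f) : ContMDiff 𝓘(ℝ, E) 𝓘(ℝ, E') ∞ f := by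
  intro x
  have h := contMDiffAt_iff.1 (hf x)
  rw [contMDiffAt_iff]
  exact ⟨h.1, (h.2.restrict_scalars ℝ).of_le le_top⟩

end LocallyConstant

namespace IsUniversalComplexification

variable {F : Type u} [NormedAddCommGroup F] [NormedSpace ℝ F]
  {K : Type u} [TopologicalSpace K] [ChartedSpace F K] [Group K]
  {E : Type u} [NormedAddCommGroup E] [NormedSpace ℂ E]
  {G : Type u} [TopologicalSpace G] [ChartedSpace E G] [Group G]
  {η : K →* G}

/-- Two holomorphic homomorphisms into a complex Lie group that agree on the image of `K` are
equal. -/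
theorem hom_ext (hη : IsUniversalComplexification F E η) {E' : Type u} [NormedAddCommGroup E']
    [NormedSpace ℂ E'] [FiniteDimensional ℂ E'] {H : Type u} [TopologicalSpace H]
    [ChartedSpace E' H] [Group H] [LieGroup 𝓘(ℂ, E') ω H] [T2Space H] {π₁ π₂ : G →* H}
    (h₁ : ContMDiff 𝓘(ℂ, E) 𝓘(ℂ, E') ω π₁) (h₂ : ContMDiff 𝓘(ℂ, E) 𝓘(ℂ, E') ω π₂)
    (h : ∀ k, π₁ (η k) = π₂ (η k)) : π₁ = π₂ := by
  have hα : ContMDiff 𝓘(ℝ, F) 𝓘(ℝ, E') ∞ (π₁.comp η) :=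
    h₁.restrictScalars_real.comp hη.contMDiff
  exact (hη.existsUnique E' H (π₁.comp η) hα).unique ⟨h₁.mdifferentiable (by simp), rfl⟩
    ⟨h₂.mdifferentiable (by simp), MonoidHom.ext fun k => (h k).symm⟩

attribute [local instance] ChartedSpace.ofDiscreteTopology in
/-- A holomorphic homomorphism that is locally constant on the compact group `K` takes no values
besides those on the image of `K`: the image of `K` is a finite group `S`, so that `K → S` extends
to `G → S`, and this extension is the given homomorphism. -/
theorem exists_eq_of_isLocallyConstant [CompactSpace K] (hη : IsUniversalComplexification F E η)
    {E' : Type u} [NormedAddCommGroup E'] [NormedSpace ℂ E'] [FiniteDimensional ℂ E'] {H : Type u}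
    [TopologicalSpace H] [ChartedSpace E' H] [Group H] [LieGroup 𝓘(ℂ, E') ω H] [T2Space H]
    {π : G →* H} (hπ : MDifferentiable 𝓘(ℂ, E) 𝓘(ℂ, E') π)
    (hloc : IsLocallyConstant fun k => π (η k)) (g : G) : ∃ k, π (η k) = π g := by
  let S := (π.comp η).range
  have hfin : Finite S := hloc.range_finite
  have hlie : LieGroup 𝓘(ℂ, PUnit.{u + 1}) ω S := lieGroup_of_discreteTopology S
  have hβ : IsLocallyConstant (π.comp η).rangeRestrict := by
    rw [IsLocallyConstant.iff_eventually_eq]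
    intro k
    filter_upwards [hloc.eventually_eq k] with k' hk'
    exact Subtype.ext hk'
  obtain ⟨α, ⟨hα, hαη⟩, -⟩ := hη.existsUnique PUnit.{u + 1} S (π.comp η).rangeRestrict hβ.contMDiff
  have hαc : IsLocallyConstant (S.subtype.comp α) :=
    ((IsLocallyConstant.iff_continuous α).2 hα.continuous).comp S.subtype
  have hα' : MDifferentiable 𝓘(ℂ, E) 𝓘(ℂ, E') (S.subtype.comp α) :=
    (hαc.contMDiff (n := 1)).mdifferentiable one_ne_zero
  have hcomp : (S.subtype.comp α).comp η = π.comp η := by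
    rw [MonoidHom.comp_assoc, hαη]
    exact MonoidHom.subtype_comp_rangeRestrict _
  have heq : S.subtype.comp α = π := (hη.existsUnique E' H (π.comp η) hloc.contMDiff).unique
    ⟨hα', hcomp⟩ ⟨hπ, rfl⟩
  obtain ⟨k, hk⟩ := (α g).2
  exact ⟨k, hk.trans (DFunLike.congr_fun heq g)⟩

variable [LieGroup 𝓘(ℂ, E) ω G]

attribute [local instance] ChartedSpace.ofDiscreteTopology in
/-- The image of `K` meets every connected component of `G`. -/
theorem exists_mem_connectedComponent [CompactSpace K] (hη : IsUniversalComplexification F E η)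
    (g : G) : ∃ k, g * (η k)⁻¹ ∈ connectedComponent (1 : G) := by
  have hG : IsTopologicalGroup G := topologicalGroup_of_lieGroup 𝓘(ℂ, E) ω
  have hL : LocallyConnectedSpace G := ChartedSpace.locallyConnectedSpace E G
  let G₀ := Subgroup.connectedComponentOfOne G
  have hG₀ : IsOpen (G₀ : Set G) := isOpen_connectedComponent
  have hn : G₀.Normal := by
    refine ⟨fun n hn g => ?_⟩
    have hc : Continuous fun x : G => g * x * g⁻¹ := by fun_prop
    have h1 := hc.image_connectedComponent_subset (1 : G) ⟨n, hn, rfl⟩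
    rw [mul_one, mul_inv_cancel] at h1
    exact h1
  have hd : DiscreteTopology (G ⧸ G₀) := QuotientGroup.discreteTopology hG₀
  have hlie : LieGroup 𝓘(ℂ, PUnit.{u + 1}) ω (G ⧸ G₀) := lieGroup_of_discreteTopology _
  have hπ : IsLocallyConstant (QuotientGroup.mk' G₀) :=
    (IsLocallyConstant.iff_continuous _).2 QuotientGroup.continuous_mk
  obtain ⟨k, hk⟩ := hη.exists_eq_of_isLocallyConstant (E' := PUnit.{u + 1})
    (π := QuotientGroup.mk' G₀) ((hπ.contMDiff (n := 1)).mdifferentiable one_ne_zero)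
    (hπ.comp_continuous hη.contMDiff.continuous) g
  refine ⟨k, ?_⟩
  rw [QuotientGroup.mk'_apply, QuotientGroup.mk'_apply, QuotientGroup.eq] at hk
  have := hn.conj_mem _ hk (η k)
  rwa [mul_inv_cancel_left] at this

/-- `G` is a union of countably many compact sets. -/
theorem sigmaCompactSpace [FiniteDimensional ℂ E] [CompactSpace K]
    (hη : IsUniversalComplexification F E η) :
    SigmaCompactSpace G := by
  have hG : IsTopologicalGroup G := topologicalGroup_of_lieGroup 𝓘(ℂ, E) ω
  have hL : LocallyCompactSpace G := Manifold.locallyCompact_of_finiteDimensional 𝓘(ℂ, E)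
  open scoped Pointwise in
  obtain ⟨V, hV, hV1⟩ := exists_compact_mem_nhds (1 : G)
  let S := V ∪ V⁻¹
  have hS : IsCompact S := hV.union hV.inv
  have hSinv : S⁻¹ = S := by simp [S, Set.union_comm]
  let T : Subgroup G :=
    { carrier := ⋃ n : ℕ, S ^ n
      mul_mem' := by
        intro a b ha hb
        obtain ⟨m, hm⟩ := Set.mem_iUnion.1 ha
        obtain ⟨n, hn⟩ := Set.mem_iUnion.1 hb
        exact Set.mem_iUnion.2 ⟨m + n, by rw [pow_add]; exact Set.mul_mem_mul hm hn⟩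
      one_mem' := Set.mem_iUnion.2 ⟨0, by simp⟩
      inv_mem' := by
        intro a ha
        obtain ⟨m, hm⟩ := Set.mem_iUnion.1 ha
        refine Set.mem_iUnion.2 ⟨m, ?_⟩
        rw [← hSinv, inv_pow]
        exact Set.inv_mem_inv.2 hm }
  have hT : IsOpen (T : Set G) := by
    refine T.isOpen_of_mem_nhds (g := 1) (Filter.mem_of_superset hV1 fun x hx => ?_)
    exact Set.mem_iUnion.2 ⟨1, by rw [pow_one]; exact Or.inl hx⟩
  have hsub : connectedComponent (1 : G) ⊆ T :=
    IsClopen.connectedComponent_subset ⟨T.isClosed_of_isOpen hT, hT⟩ T.one_mem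
  have hK : IsCompact (Set.range η) := isCompact_range hη.contMDiff.continuous
  have hpow : ∀ n : ℕ, IsCompact (S ^ n) := by
    intro n
    induction n with
    | zero => simp
    | succ n ih => rw [pow_succ]; exact ih.mul hS
  rw [← isSigmaCompact_univ_iff]
  have huniv : (Set.univ : Set G) = ⋃ n : ℕ, S ^ n * Set.range η := by
    refine (Set.eq_univ_of_forall fun g => ?_).symm
    obtain ⟨k, hk⟩ := hη.exists_mem_connectedComponent g
    obtain ⟨n, hn⟩ := Set.mem_iUnion.1 (hsub hk)
    exact Set.mem_iUnion.2 ⟨n, Set.mem_mul.2 ⟨_, hn, η k, ⟨k, rfl⟩, by simp⟩⟩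
  rw [huniv]
  exact isSigmaCompact_iUnion_of_isCompact _ fun n => (hpow n).mul hK

end IsUniversalComplexification

/-! ### The adjoint representation and complete reducibility -/

section Adjoint

variable {E : Type u} [NormedAddCommGroup E] [NormedSpace ℂ E]
  {G : Type u} [TopologicalSpace G] [ChartedSpace E G] [Group G] [LieGroup 𝓘(ℂ, E) ω G]

theorem contMDiff_conj (g : G) : ContMDiff 𝓘(ℂ, E) 𝓘(ℂ, E) ω fun x : G => g * x * g⁻¹ :=
  (contMDiff_mul_right (a := g⁻¹)).comp (contMDiff_mul_left (a := g))

/-- The adjoint action of an element `g` on the tangent space `E` of `G` at the identity: the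
derivative of `x ↦ g * x * g⁻¹`. -/
def adjointMap (g : G) : E →L[ℂ] E :=
  mfderiv 𝓘(ℂ, E) 𝓘(ℂ, E) (fun x : G => g * x * g⁻¹) 1

/-- The base point is a variable `y` with `y = 1`, so that the chain rule applies at points such as
`h * 1 * h⁻¹`, whose tangent space is only propositionally that at `1`. -/
theorem hasMFDerivAt_conj (g y : G) (hy : y = 1) :
    HasMFDerivAt 𝓘(ℂ, E) 𝓘(ℂ, E) (fun x : G => g * x * g⁻¹) y (adjointMap (E := E) g) := by
  subst hy
  exact ((contMDiff_conj g).mdifferentiable (by simp) 1).hasMFDerivAt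

theorem adjointMap_mul (g h : G) :
    adjointMap (E := E) (g * h) = adjointMap g * adjointMap h := by
  have h1 := (hasMFDerivAt_conj (E := E) g (h * 1 * h⁻¹) (by simp)).comp (1 : G)
    (hasMFDerivAt_conj h 1 rfl)
  have h2 := hasMFDerivAt_conj (E := E) (g * h) 1 rfl
  have e : (fun x : G => g * x * g⁻¹) ∘ (fun x => h * x * h⁻¹)
      = fun x => g * h * x * (g * h)⁻¹ := by
    funext x; simp [mul_assoc]
  rw [e] at h1
  exact hasMFDerivAt_unique h2 h1

theorem adjointMap_one : adjointMap (E := E) (1 : G) = 1 := by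
  have h2 := hasMFDerivAt_conj (E := E) (1 : G) 1 rfl
  have e : (fun x : G => 1 * x * 1⁻¹) = id := by funext x; simp
  rw [e] at h2
  exact hasMFDerivAt_unique h2 (hasMFDerivAt_id 1)

/-- The adjoint representation. -/
def adjointRep : G →* (E →L[ℂ] E)ˣ :=
  MonoidHom.toHomUnits
    { toFun := adjointMap
      map_one' := adjointMap_one
      map_mul' := adjointMap_mul }

theorem contMDiff_adjointMap :
    ContMDiff 𝓘(ℂ, E) 𝓘(ℂ, E →L[ℂ] E) ω (adjointMap : G → E →L[ℂ] E) := by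
  intro x₀
  have h1 : ContMDiff (𝓘(ℂ, E).prod 𝓘(ℂ, E)) 𝓘(ℂ, E) ω
      (Function.uncurry fun g x : G => g * x * g⁻¹) :=
    (contMDiff_fst.mul contMDiff_snd).mul contMDiff_fst.inv
  have h2 := ContMDiffAt.mfderiv (m := ω) (n := ω) (x₀ := x₀) (fun g x : G => g * x * g⁻¹)
    (fun _ : G => (1 : G)) (h1 (x₀, 1)) contMDiffAt_const (by simp)
  refine h2.congr_of_eventuallyEq (Filter.Eventually.of_forall fun g => ?_)
  have hm : (1 : G) ∈ (chartAt E (1 : G)).source := mem_chart_source E 1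
  have h3 : inTangentCoordinates 𝓘(ℂ, E) 𝓘(ℂ, E) (fun _ : G => (1 : G)) (fun g => g * 1 * g⁻¹)
      adjointMap x₀ g = adjointMap (E := E) g := by
    rw [inTangentCoordinates_eq (fun _ : G => (1 : G)) (fun g => g * 1 * g⁻¹) adjointMap hm
      (by simp)]
    simp only [mul_one, mul_inv_cancel]
    ext v
    simp only [ContinuousLinearMap.comp_apply]
    rw [(tangentBundleCore 𝓘(ℂ, E) G).coordChange_self _ _ hm,
      (tangentBundleCore 𝓘(ℂ, E) G).coordChange_self _ _ hm]
  exact h3.symm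

theorem contMDiff_adjointRep [CompleteSpace E] :
    ContMDiff 𝓘(ℂ, E) 𝓘(ℂ, E →L[ℂ] E) ω (adjointRep : G → (E →L[ℂ] E)ˣ) :=
  ContMDiff.of_comp_isOpenEmbedding Units.isOpenEmbedding_val contMDiff_adjointMap

end Adjoint

section Averaging

open MeasureTheory

/-- A projection `p` onto a subspace invariant under a compact group can be averaged to one that
commutes with the group. -/
theorem exists_commute_of_invariant {K : Type*} [TopologicalSpace K] [Group K]
    [IsTopologicalGroup K] [CompactSpace K] [T2Space K] {A : Type*} [NormedRing A]
    [NormedAlgebra ℝ A] [FiniteDimensional ℝ A] (a : K →* Aˣ) (ha : Continuous a) (p : A)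
    (hp : ∀ k, p * (a k * p) = a k * p) :
    ∃ q : A, (∀ k, Commute q (a k)) ∧ p * q = q ∧ q * p = p := by
  have : CompleteSpace A := FiniteDimensional.complete ℝ A
  let _ : MeasurableSpace K := borel K
  have : BorelSpace K := ⟨rfl⟩
  let μ : Measure K := Measure.haarMeasure ⊤
  have hμ : IsProbabilityMeasure μ := ⟨Measure.haarMeasure_self⟩
  let f : K → A := fun k => a k * p * ↑(a k)⁻¹
  have hf : Continuous f := by
    have h1 : Continuous fun k => ((a k : Aˣ) : A) := Units.continuous_val.comp ha
    have h2 : Continuous fun k => (((a k)⁻¹ : Aˣ) : A) := Units.continuous_val.comp ha.inv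
    exact (h1.mul continuous_const).mul h2
  have hint : Integrable f μ :=
    hf.integrable_of_hasCompactSupport (HasCompactSupport.of_compactSpace f)
  have hleft : ∀ b : A, ∫ k, b * f k ∂μ = b * ∫ k, f k ∂μ := fun b =>
    (ContinuousLinearMap.mul ℝ A b).integral_comp_comm hint
  have hright : ∀ b : A, ∫ k, f k * b ∂μ = (∫ k, f k ∂μ) * b := fun b =>
    ((ContinuousLinearMap.mul ℝ A).flip b).integral_comp_comm hint
  refine ⟨∫ k, f k ∂μ, fun h => ?_, ?_, ?_⟩
  · have h1 : ∀ k, (a h : A) * f k = f (h * k) * a h := by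
      intro k
      simp only [f, map_mul, mul_inv_rev, Units.val_mul, mul_assoc, Units.inv_mul, mul_one]
    change (∫ k, f k ∂μ) * (a h : A) = (a h : A) * ∫ k, f k ∂μ
    rw [← hleft]
    simp_rw [h1]
    rw [← hright]
    exact (integral_mul_left_eq_self (μ := μ) (fun k => f k * (a h : A)) h).symm
  · rw [← hleft]
    refine integral_congr_ae (Filter.Eventually.of_forall fun k => ?_)
    simp only [f, ← mul_assoc]
    rw [mul_assoc p, hp]
  · rw [← hright]
    have h1 : ∀ k, f k * p = p := by
      intro k
      have h2 := hp k⁻¹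
      have h3 : (a k : A) * (p * (a k⁻¹ * p)) = p := by
        rw [h2, ← mul_assoc, ← Units.val_mul, ← map_mul]; simp
      simpa [f, mul_assoc] using h3
    simp [h1]

end Averaging

namespace IsUniversalComplexification

variable {F : Type u} [NormedAddCommGroup F] [NormedSpace ℝ F]
  {K : Type u} [TopologicalSpace K] [ChartedSpace F K] [Group K]
  {E : Type u} [NormedAddCommGroup E] [NormedSpace ℂ E] [FiniteDimensional ℂ E]
  {G : Type u} [TopologicalSpace G] [ChartedSpace E G] [Group G] [LieGroup 𝓘(ℂ, E) ω G]
  {η : K →* G}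

/-- A complex subspace of the Lie algebra of `G` that is invariant under the adjoint action of `K`
is invariant under that of `G`. Indeed a projection `q` onto it commutes with `K`, so the adjoint
representation and its conjugate by the invertible operator `2 - q` agree on `K`. -/
theorem adjointMap_mem [IsTopologicalGroup K] [CompactSpace K] [T2Space K]
    (hη : IsUniversalComplexification F E η) {𝔫 : Submodule ℂ E}
    (h𝔫 : ∀ k, ∀ X ∈ 𝔫, adjointMap (η k) X ∈ 𝔫) (g : G) {X : E} (hX : X ∈ 𝔫) :
    adjointMap g X ∈ 𝔫 := by
  have : CompleteSpace E := FiniteDimensional.complete ℂ E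
  have : FiniteDimensional ℝ (E →L[ℂ] E) := FiniteDimensional.complexToReal _
  obtain ⟨p₀, hp₀⟩ := 𝔫.subtype.exists_leftInverse_of_injective 𝔫.ker_subtype
  let p : E →L[ℂ] E := LinearMap.toContinuousLinearMap (𝔫.subtype ∘ₗ p₀)
  have hpmem : ∀ x, p x ∈ 𝔫 := fun x => (p₀ x).2
  have hpid : ∀ x ∈ 𝔫, p x = x := fun x hx =>
    congrArg Subtype.val (LinearMap.congr_fun hp₀ ⟨x, hx⟩)
  have hAd : Continuous fun k => (adjointRep (η k) : (E →L[ℂ] E)ˣ) :=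
    (contMDiff_adjointRep (E := E) (G := G)).continuous.comp hη.contMDiff.continuous
  obtain ⟨q, hq, hpq, hqp⟩ := exists_commute_of_invariant
    ((adjointRep : G →* (E →L[ℂ] E)ˣ).comp η) hAd p fun k => by
      ext x
      exact hpid _ (h𝔫 k _ (hpmem x))
  have hqq : q * q = q := by
    calc q * q = q * (p * q) := by rw [hpq]
      _ = (q * p) * q := (mul_assoc _ _ _).symm
      _ = q := by rw [hqp, hpq]
  let s : (E →L[ℂ] E)ˣ :=
    { val := 2 - q
      inv := (2⁻¹ : ℂ) • (1 + q)
      val_inv := by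
        rw [mul_smul_comm, sub_mul, mul_add, mul_add, hqq, mul_one, mul_one]
        rw [show (2 : E →L[ℂ] E) + 2 * q - (q + q) = (2 : ℂ) • 1 by
          rw [two_mul, add_sub_cancel_right, two_smul, one_add_one_eq_two]]
        rw [smul_smul]; norm_num
      inv_val := by
        rw [smul_mul_assoc, add_mul, mul_sub, mul_sub, hqq, one_mul, one_mul]
        rw [show (2 : E →L[ℂ] E) - q + (q * 2 - q) = (2 : ℂ) • 1 by
          rw [mul_two, add_sub_cancel_right, sub_add_cancel, two_smul, one_add_one_eq_two]]
        rw [smul_smul]; norm_num }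
  have hs : ∀ b : (E →L[ℂ] E)ˣ, s * b * s⁻¹ = b ↔ Commute q (b : E →L[ℂ] E) := by
    intro b
    rw [mul_inv_eq_iff_eq_mul, Units.ext_iff]
    simp only [s, Units.val_mul, sub_mul, mul_sub, two_mul, mul_two, sub_right_inj]
    rfl
  have key : (MulAut.conj s).toMonoidHom.comp adjointRep
      = (adjointRep : G →* (E →L[ℂ] E)ˣ) := by
    refine hη.hom_ext ?_ contMDiff_adjointRep fun k => (hs _).2 (hq k)
    exact (contMDiff_const.mul contMDiff_adjointRep).mul contMDiff_const
  have hg : q * adjointMap g = adjointMap g * q := (hs _).1 (DFunLike.congr_fun key g)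
  have h1 : p * (adjointMap g * p) = adjointMap g * p := by
    calc p * (adjointMap g * p) = p * (adjointMap g * (q * p)) := by rw [hqp]
      _ = (p * q) * (adjointMap g * p) := by
        rw [← mul_assoc (adjointMap g), ← hg]; simp only [mul_assoc]
      _ = (q * adjointMap g) * p := by rw [hpq, mul_assoc]
      _ = adjointMap g * p := by rw [hg, mul_assoc, hqp]
  have h2 : p (adjointMap g (p X)) = adjointMap g (p X) := DFunLike.congr_fun h1 X
  rw [hpid X hX] at h2
  rw [← h2]
  exact hpmem _

end IsUniversalComplexification

/-! ### Holomorphic functions that are locally constant along `K` -/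

/-- A map into a normed space whose derivative vanishes everywhere is locally constant. -/
theorem isLocallyConstant_of_hasMFDerivAt_zero {F : Type*} [NormedAddCommGroup F] [NormedSpace ℝ F]
    {K : Type*} [TopologicalSpace K] [ChartedSpace F K] [IsManifold 𝓘(ℝ, F) 1 K]
    {V : Type*} [NormedAddCommGroup V] [NormedSpace ℝ V] {u : K → V}
    (hu : ∀ k, HasMFDerivAt 𝓘(ℝ, F) 𝓘(ℝ, V) u k 0) : IsLocallyConstant u := by
  rw [IsLocallyConstant.iff_eventually_eq]
  intro k
  let e := extChartAt 𝓘(ℝ, F) k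
  have hopen : IsOpen e.target := isOpen_extChartAt_target k
  obtain ⟨R, hR, hball⟩ := Metric.isOpen_iff.1 hopen _ (mem_extChartAt_target (I := 𝓘(ℝ, F)) k)
  have hd : ∀ z ∈ e.target, HasFDerivAt (u ∘ e.symm) (0 : F →L[ℝ] V) z := by
    intro z hz
    have hsymm : MDifferentiableAt 𝓘(ℝ, F) 𝓘(ℝ, F) e.symm z :=
      ((contMDiffOn_extChartAt_symm (n := 1) k).mdifferentiableOn one_ne_zero).mdifferentiableAt
        (hopen.mem_nhds hz)
    have h : HasMFDerivAt 𝓘(ℝ, F) 𝓘(ℝ, V) (u ∘ e.symm) z (0 : F →L[ℝ] V) := by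
      convert! (hu (e.symm z)).comp z hsymm.hasMFDerivAt using 1
    exact hasMFDerivAt_iff_hasFDerivAt.1 h
  have hconst : ∀ z ∈ Metric.ball (e k) R, (u ∘ e.symm) z = (u ∘ e.symm) (e k) := by
    intro z hz
    refine (convex_ball (e k) R).is_const_of_fderivWithin_eq_zero (𝕜 := ℝ) (f := u ∘ e.symm)
      (fun y hy => (hd y (hball hy)).differentiableAt.differentiableWithinAt) (fun y hy => ?_) hz
      (Metric.mem_ball_self hR)
    rw [fderivWithin_of_isOpen Metric.isOpen_ball hy, (hd y (hball hy)).fderiv]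
  have h1 : ∀ᶠ k' in 𝓝 k, e k' ∈ Metric.ball (e k) R :=
    (continuousAt_extChartAt (I := 𝓘(ℝ, F)) k).eventually (Metric.ball_mem_nhds _ hR)
  filter_upwards [h1, extChartAt_source_mem_nhds (I := 𝓘(ℝ, F)) k] with k' hk' hs
  have := hconst _ hk'
  rwa [Function.comp_apply, Function.comp_apply, e.left_inv hs,
    e.left_inv (mem_extChartAt_source (I := 𝓘(ℝ, F)) k)] at this

/-- The derivative of a holomorphic map is also its derivative as a map of real manifolds. -/
theorem HasMFDerivAt.restrictScalars_real {E : Type*} [NormedAddCommGroup E] [NormedSpace ℂ E]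
    {M : Type*} [TopologicalSpace M] [ChartedSpace E M]
    {E' : Type*} [NormedAddCommGroup E'] [NormedSpace ℂ E'] {f : M → E'} {x : M} {f' : E →L[ℂ] E'}
    (hf : HasMFDerivAt 𝓘(ℂ, E) 𝓘(ℂ, E') f x f') :
    HasMFDerivAt 𝓘(ℝ, E) 𝓘(ℝ, E') f x (f'.restrictScalars ℝ) :=
  ⟨hf.1, HasFDerivWithinAt.restrictScalars ℝ (f' := f') hf.2⟩

namespace HolomorphicFunctions

open AnalyticFunctional

variable {E : Type u} [NormedAddCommGroup E] [NormedSpace ℂ E]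
  {G : Type u} [TopologicalSpace G] [ChartedSpace E G] [Group G]

/-- The differential at the identity of a holomorphic function on `G`. -/
def differentialOne (f : HolomorphicFunctions E G) : E →L[ℂ] ℂ :=
  mfderiv 𝓘(ℂ, E) 𝓘(ℂ, ℂ) f 1

theorem hasMFDerivAt_differentialOne (f : HolomorphicFunctions E G) {y : G} (hy : y = 1) :
    HasMFDerivAt 𝓘(ℂ, E) 𝓘(ℂ, ℂ) f y f.differentialOne := by
  subst hy
  exact (f.mdifferentiable 1).hasMFDerivAt

/-- The differential at the identity as a linear map on `𝒪(G)`. -/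
def differentialOneₗ : HolomorphicFunctions E G →ₗ[ℂ] Module.Dual ℂ E where
  toFun f := f.differentialOne
  map_add' f g := by
    have h := hasMFDerivAt_unique ((f + g).hasMFDerivAt_differentialOne rfl)
      ((f.hasMFDerivAt_differentialOne rfl).add (g.hasMFDerivAt_differentialOne rfl))
    exact congrArg (fun T : E →L[ℂ] ℂ => (T : E →ₗ[ℂ] ℂ)) h
  map_smul' c f := by
    have h := hasMFDerivAt_unique ((c • f).hasMFDerivAt_differentialOne rfl)
      ((f.hasMFDerivAt_differentialOne rfl).const_smul c)
    exact congrArg (fun T : E →L[ℂ] ℂ => (T : E →ₗ[ℂ] ℂ)) h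

@[simp] theorem differentialOneₗ_apply (f : HolomorphicFunctions E G) (X : E) :
    differentialOneₗ f X = f.differentialOne X := rfl

variable [LieGroup 𝓘(ℂ, E) ω G]

/-- The function `x ↦ f (x * g)`. -/
def rightTranslate (g : G) (f : HolomorphicFunctions E G) : HolomorphicFunctions E G :=
  .mk (fun x => f (x * g)) <|
    f.mdifferentiable.comp ((contMDiff_mul_right (I := 𝓘(ℂ, E)) (n := ω)).mdifferentiable (by simp))

@[simp] theorem rightTranslate_apply (g x : G) (f : HolomorphicFunctions E G) :
    rightTranslate g f x = f (x * g) := rfl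

/-- The chain rule for `x ↦ f (g * x * g⁻¹)`. -/
theorem differentialOne_conj (g : G) (f : HolomorphicFunctions E G) :
    (leftTranslate g (rightTranslate g⁻¹ f)).differentialOne
      = f.differentialOne.comp (adjointMap g) := by
  have h1 := (f.hasMFDerivAt_differentialOne (y := g * 1 * g⁻¹) (by simp)).comp (1 : G)
    (hasMFDerivAt_conj g 1 rfl)
  exact hasMFDerivAt_unique ((leftTranslate g (rightTranslate g⁻¹ f)).hasMFDerivAt_differentialOne
    rfl) h1

end HolomorphicFunctions

namespace IsUniversalComplexification

open HolomorphicFunctions AnalyticFunctional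

variable {F : Type u} [NormedAddCommGroup F] [NormedSpace ℝ F]
  {K : Type u} [TopologicalSpace K] [ChartedSpace F K] [Group K]
  {E : Type u} [NormedAddCommGroup E] [NormedSpace ℂ E]
  {G : Type u} [TopologicalSpace G] [ChartedSpace E G] [Group G]

/-- The holomorphic functions on `G` that are locally constant along the cosets of `K`, that is,
those for which `k ↦ f (x * η k)` is locally constant for every `x`. -/
def locallyInvariant (E : Type u) [NormedAddCommGroup E] [NormedSpace ℂ E]
    [ChartedSpace E G] (η : K →* G) : Submodule ℂ (HolomorphicFunctions E G) where
  carrier := {f | ∀ x, IsLocallyConstant fun k => f (x * η k)}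
  add_mem' hf hg x := (hf x).add (hg x)
  zero_mem' _ := IsLocallyConstant.const 0
  smul_mem' c _ hf x := (hf x).comp (c * ·)

variable [LieGroup 𝓘(ℂ, E) ω G] {η : K →* G}

theorem leftTranslate_mem_locallyInvariant {f : HolomorphicFunctions E G}
    (hf : f ∈ locallyInvariant E η) (g : G) : leftTranslate g f ∈ locallyInvariant E η := by
  intro x
  simpa [mul_assoc] using hf (g * x)

theorem rightTranslate_mem_locallyInvariant_of_mem_range [IsTopologicalGroup K]
    {f : HolomorphicFunctions E G} (hf : f ∈ locallyInvariant E η) (k₀ : K) :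
    rightTranslate (η k₀) f ∈ locallyInvariant E η := by
  intro x
  have hc : Continuous fun k : K => k₀⁻¹ * k * k₀ := by fun_prop
  have := (hf (x * η k₀)).comp_continuous hc
  simpa [Function.comp_def, mul_assoc] using this

omit [LieGroup 𝓘(ℂ, E) ω G] in
theorem hasMFDerivAt_comp (hη : IsUniversalComplexification F E η) (f : HolomorphicFunctions E G) :
    HasMFDerivAt 𝓘(ℝ, F) 𝓘(ℝ, ℂ) (f ∘ η) 1
      ((f.differentialOne.restrictScalars ℝ).comp (mfderiv 𝓘(ℝ, F) 𝓘(ℝ, E) η 1 : F →L[ℝ] E)) := by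
  have h1 := (f.hasMFDerivAt_differentialOne (y := η 1) (map_one η)).restrictScalars_real
  exact h1.comp 1 (hη.contMDiff.mdifferentiable (by simp) 1).hasMFDerivAt

omit [LieGroup 𝓘(ℂ, E) ω G] in
theorem differentialOne_comp_eq_zero (hη : IsUniversalComplexification F E η)
    {f : HolomorphicFunctions E G} (hf : f ∈ locallyInvariant E η) (v : F) :
    f.differentialOne ((mfderiv 𝓘(ℝ, F) 𝓘(ℝ, E) η 1 : F →L[ℝ] E) v) = 0 := by
  have h1 := hf 1
  simp only [one_mul] at h1
  have h2 : HasMFDerivAt 𝓘(ℝ, F) 𝓘(ℝ, ℂ) (f ∘ η) 1 (0 : F →L[ℝ] ℂ) :=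
    (hasMFDerivAt_const (f 1) (1 : K)).congr_of_eventuallyEq (by
      filter_upwards [h1.eventually_eq 1] with k hk
      simpa using hk)
  exact DFunLike.congr_fun (hasMFDerivAt_unique (hη.hasMFDerivAt_comp f) h2) v

/-- The vectors at the identity that annihilate the functions locally constant along `K`. -/
def locallyInvariantKernel (E : Type u) [NormedAddCommGroup E] [NormedSpace ℂ E]
    [ChartedSpace E G] (η : K →* G) : Submodule ℂ E :=
  ((locallyInvariant E η).map differentialOneₗ).dualCoannihilator

omit [LieGroup 𝓘(ℂ, E) ω G] in
theorem mem_locallyInvariantKernel {X : E} : X ∈ locallyInvariantKernel E η ↔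
    ∀ f ∈ locallyInvariant E η, f.differentialOne X = 0 := by
  simp [locallyInvariantKernel, Submodule.mem_dualCoannihilator]

/-- A holomorphic function is locally constant along the cosets of `K` if the differentials of its
left translates vanish on `locallyInvariantKernel`, since this kernel contains the image of the
derivative of `η` at the identity. -/
theorem mem_locallyInvariant_of_differentialOne [LieGroup 𝓘(ℝ, F) ∞ K]
    (hη : IsUniversalComplexification F E η)
    {f : HolomorphicFunctions E G}
    (hf : ∀ x, ∀ X ∈ locallyInvariantKernel E η, (leftTranslate x f).differentialOne X = 0) :
    f ∈ locallyInvariant E η := by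
  have : IsManifold 𝓘(ℝ, F) 1 K := IsManifold.of_le (n := ∞) (by simp)
  intro x
  refine isLocallyConstant_of_hasMFDerivAt_zero (F := F) fun k₀ => ?_
  have h0 : ((leftTranslate (x * η k₀) f).differentialOne.restrictScalars ℝ).comp
      (mfderiv 𝓘(ℝ, F) 𝓘(ℝ, E) η 1 : F →L[ℝ] E) = 0 := by
    ext v
    refine hf _ _ ?_
    exact mem_locallyInvariantKernel.2 fun f hf => hη.differentialOne_comp_eq_zero hf v
  have h1 : ∀ y : K, y = 1 → HasMFDerivAt 𝓘(ℝ, F) 𝓘(ℝ, ℂ) (leftTranslate (x * η k₀) f ∘ η) y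
      (0 : F →L[ℝ] ℂ) := by
    rintro _ rfl
    exact h0 ▸ hη.hasMFDerivAt_comp (leftTranslate (x * η k₀) f)
  have h2 : MDifferentiable 𝓘(ℝ, F) 𝓘(ℝ, F) fun k : K => k₀⁻¹ * k :=
    (contMDiff_mul_left (I := 𝓘(ℝ, F)) (n := ∞)).mdifferentiable (by simp)
  have h3 := (h1 _ (inv_mul_cancel k₀)).comp k₀ (h2 k₀).hasMFDerivAt
  have e : (leftTranslate (x * η k₀) f ∘ η) ∘ (fun k : K => k₀⁻¹ * k) = fun k => f (x * η k) := by
    funext k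
    simp [mul_assoc]
  rw [e] at h3
  convert! h3 using 1

variable [FiniteDimensional ℂ E]

/-- The functions locally constant along `K` are stable under all right translations, since their
kernel in the Lie algebra is stable under the adjoint representation. -/
theorem rightTranslate_mem_locallyInvariant [LieGroup 𝓘(ℝ, F) ∞ K] [CompactSpace K] [T2Space K]
    (hη : IsUniversalComplexification F E η)
    {f : HolomorphicFunctions E G} (hf : f ∈ locallyInvariant E η) (g : G) :
    rightTranslate g f ∈ locallyInvariant E η := by
  have hK : IsTopologicalGroup K := topologicalGroup_of_lieGroup 𝓘(ℝ, F) ∞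
  refine hη.mem_locallyInvariant_of_differentialOne fun x X hX => ?_
  have e : leftTranslate x (rightTranslate g f)
      = leftTranslate g⁻¹ (rightTranslate g⁻¹⁻¹ (leftTranslate (x * g) f)) := by
    ext y
    simp [mul_assoc]
  rw [e, differentialOne_conj]
  refine mem_locallyInvariantKernel.1 (hη.adjointMap_mem (fun k Y hY => ?_) g⁻¹ hX) _
    (leftTranslate_mem_locallyInvariant hf _)
  refine mem_locallyInvariantKernel.2 fun f hf => ?_
  have h1 := mem_locallyInvariantKernel.1 hY (leftTranslate (η k) (rightTranslate (η k)⁻¹ f)) (by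
    rw [← map_inv]
    exact leftTranslate_mem_locallyInvariant
      (rightTranslate_mem_locallyInvariant_of_mem_range hf k⁻¹) _)
  rwa [differentialOne_conj] at h1

end IsUniversalComplexification

/-! ### Local coordinates transverse to a subgroup defined by holomorphic functions -/

/-- A holomorphic map `φ` into a subspace `W`, whose derivative at `a` is a projection onto `W`,
becomes that projection in suitable local coordinates. -/
theorem exists_straightening {E : Type u} [NormedAddCommGroup E] [NormedSpace ℂ E]
    [FiniteDimensional ℂ E] {W : Submodule ℂ E} (p : E →L[ℂ] W) (hp : ∀ w : W, p w = w)
    {φ : E → W} {a : E} (hφ : ContDiffAt ℂ ω φ a) (hφ' : HasFDerivAt φ p a) (hφa : φ a = 0) :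
    ∃ T : OpenPartialHomeomorph E E, a ∈ T.source ∧ T a = 0 ∧ (∀ z, p (T z) = φ z) ∧
      ∀ᶠ y in 𝓝 (0 : E), ContDiffAt ℂ ω T.symm y := by
  have : CompleteSpace E := FiniteDimensional.complete ℂ E
  let θ : E → E := fun z => (φ z : E) + ((z - a) - (p (z - a) : E))
  have hθ : ContDiffAt ℂ ω θ a :=
    (W.subtypeL.contDiff.contDiffAt.comp a hφ).add
      ((contDiffAt_id.sub contDiffAt_const).sub
        ((W.subtypeL.comp p).contDiff.contDiffAt.comp a (contDiffAt_id.sub contDiffAt_const)))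
  have hθ' : HasFDerivAt θ ((ContinuousLinearEquiv.refl ℂ E : E ≃L[ℂ] E) : E →L[ℂ] E) a := by
    have h1 : HasFDerivAt (fun z : E => z - a) (ContinuousLinearMap.id ℂ E) a :=
      (hasFDerivAt_id a).sub_const a
    have h2 := (W.subtypeL.hasFDerivAt.comp a hφ').add
      (h1.sub ((W.subtypeL.comp p).hasFDerivAt.comp a h1))
    convert! h2 using 1
    ext v
    simp
  have hθa : θ a = 0 := by simp [θ, hφa]
  let T := hθ.toOpenPartialHomeomorph θ hθ' (by simp)
  have hTa : a ∈ T.source := hθ.mem_toOpenPartialHomeomorph_source hθ' (by simp)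
  refine ⟨T, hTa, hθa, fun z => ?_, ?_⟩
  · change p (θ z) = φ z
    simp [θ, hp]
  · refine ContDiffAt.eventually ?_ (by simp)
    have h0 : (0 : E) ∈ T.target := by
      have := T.map_source hTa
      rwa [show T a = 0 from hθa] at this
    have hs : T.symm 0 = a := by
      rw [← show T a = 0 from hθa, T.left_inv hTa]
    exact T.contDiffAt_symm h0 (f₀' := ContinuousLinearEquiv.refl ℂ E)
      (by rw [hs]; exact hθ') (by rw [hs]; exact hθ)

open HolomorphicFunctions AnalyticFunctional

/-- Coordinates near the identity of `G` on the cosets of a subgroup `N`: a map `f : G → W`,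
constant on the cosets `g N`, that maps the open set `U` to the ball of radius `r`, separates the
cosets that meet `U`, and has the holomorphic section `s` over the ball. -/
structure TransverseCoordinates (E : Type u) [NormedAddCommGroup E] [NormedSpace ℂ E]
    {G : Type u} [TopologicalSpace G] [ChartedSpace E G] [Group G] (N : Subgroup G)
    (W : Type u) [NormedAddCommGroup W] [NormedSpace ℂ W] where
  /-- The coordinate map. -/
  f : G → W
  /-- The section. -/
  s : W → G
  /-- The domain of the coordinates. -/
  U : Set G
  /-- The radius of the image. -/
  r : ℝ
  contMDiff_f : ContMDiff 𝓘(ℂ, E) 𝓘(ℂ, W) ω f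
  f_mul : ∀ x, ∀ n ∈ N, f (x * n) = f x
  isOpen_U : IsOpen U
  one_mem_U : 1 ∈ U
  f_mem : ∀ g ∈ U, f g ∈ Metric.ball 0 r
  s_mem : ∀ w ∈ Metric.ball 0 r, s w ∈ U
  f_s : ∀ w ∈ Metric.ball 0 r, f (s w) = w
  contMDiffOn_s : ContMDiffOn 𝓘(ℂ, W) 𝓘(ℂ, E) ω s (Metric.ball 0 r)
  inv_mul_mem : ∀ g ∈ U, ∀ h ∈ U, f g = f h → g⁻¹ * h ∈ N

section Transverse

variable {E : Type u} [NormedAddCommGroup E] [NormedSpace ℂ E]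
  {G : Type u} [TopologicalSpace G] [ChartedSpace E G] [Group G]

/-- The right stabilizer of a set of functions on `G`. -/
def rightStabilizer (R : Submodule ℂ (HolomorphicFunctions E G)) : Subgroup G where
  carrier := {n | ∀ f ∈ R, ∀ x, f (x * n) = f x}
  mul_mem' ha hb f hf x := by rw [← mul_assoc, hb f hf, ha f hf]
  one_mem' f _ x := by rw [mul_one]
  inv_mem' {a} ha f hf x := by
    have := ha f hf (x * a⁻¹)
    rw [inv_mul_cancel_right] at this
    exact this.symm

theorem mem_rightStabilizer {R : Submodule ℂ (HolomorphicFunctions E G)} {n : G} :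
    n ∈ rightStabilizer R ↔ ∀ f ∈ R, ∀ x, f (x * n) = f x := Iff.rfl

variable [LieGroup 𝓘(ℂ, E) ω G]

/-- Let `R` be a space of functions stable under left translations, `𝔫` the common kernel of their
differentials at the identity, and `p` the projection along `𝔫`. If a map `σ` from a neighbourhood
of `y` in `E` to `G` is such that functions `F i` in `R` pull back to coordinates of `p`, then the
derivatives at `y` of all functions in `R` vanish on `𝔫`. -/
theorem hasFDerivAt_apply_eq_zero [FiniteDimensional ℂ E]
    {R : Submodule ℂ (HolomorphicFunctions E G)}
    (hR : ∀ g, ∀ f ∈ R, leftTranslate g f ∈ R) {ι : Type*} [Fintype ι] {W : Submodule ℂ E}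
    (b : Module.Basis ι ℂ W) (p : E →L[ℂ] W) (hp : ∀ w : W, p w = w)
    (hker : p.ker = (R.map differentialOneₗ).dualCoannihilator)
    {F : ι → HolomorphicFunctions E G} (hF : ∀ i, F i ∈ R) {σ : E → G} {y : E}
    (hσ : MDifferentiableAt 𝓘(ℂ, E) 𝓘(ℂ, E) σ y) (c : ι → ℂ)
    (hσF : ∀ᶠ z in 𝓝 y, ∀ i, F i (σ z) = b.coord i (p z) + c i)
    {f : HolomorphicFunctions E G} (hf : f ∈ R) :
    ∃ D : E →L[ℂ] ℂ, HasFDerivAt (f ∘ σ) D y ∧ ∀ v ∈ p.ker, D v = 0 := by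
  let M : E →L[ℂ] E := mfderiv 𝓘(ℂ, E) 𝓘(ℂ, E) (fun z => (σ y)⁻¹ * σ z) y
  have hmul : MDifferentiableAt 𝓘(ℂ, E) 𝓘(ℂ, E) (fun z => (σ y)⁻¹ * σ z) y :=
    ((contMDiff_mul_left (I := 𝓘(ℂ, E)) (n := ω) (a := (σ y)⁻¹)).mdifferentiable
      (by simp) (σ y)).comp y hσ
  -- the derivative of `f ∘ σ` in terms of the differential at the identity of a left translate
  have hcomp : ∀ f : HolomorphicFunctions E G,
      HasFDerivAt (f ∘ σ) ((leftTranslate (σ y) f).differentialOne.comp M) y := by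
    intro f
    have h1 := ((leftTranslate (σ y) f).hasMFDerivAt_differentialOne
      (y := (σ y)⁻¹ * σ y) (inv_mul_cancel _)).comp y hmul.hasMFDerivAt
    have e : ⇑(leftTranslate (σ y) f) ∘ (fun z => (σ y)⁻¹ * σ z) = f ∘ σ := by
      funext z
      simp
    rw [e] at h1
    exact hasMFDerivAt_iff_hasFDerivAt.1 h1
  let q : E →ₗ[ℂ] W := ∑ i, (leftTranslate (σ y) (F i)).differentialOne.toLinearMap.smulRight (b i)
  have hqM : ∀ v, q (M v) = p v := by
    intro v
    have h1 : ∀ i, (leftTranslate (σ y) (F i)).differentialOne (M v) = b.coord i (p v) := by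
      intro i
      have h2 : HasFDerivAt (F i ∘ σ)
          ((LinearMap.toContinuousLinearMap (b.coord i)).comp p) y := by
        refine HasFDerivAt.congr_of_eventuallyEq
          ((((LinearMap.toContinuousLinearMap (b.coord i)).comp p).hasFDerivAt).add_const (c i)) ?_
        filter_upwards [hσF] with z hz
        simpa using hz i
      exact DFunLike.congr_fun ((hcomp (F i)).unique h2) v
    have h3 : q (M v) = ∑ i, b.coord i (p v) • b i := by
      simp only [q, LinearMap.sum_apply, LinearMap.smulRight_apply]
      exact Finset.sum_congr rfl fun i _ => by rw [← h1]; rfl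
    rw [h3]
    exact b.sum_repr (p v)
  have hann : ∀ f ∈ R, ∀ X ∈ p.ker, (leftTranslate (σ y) f).differentialOne X = 0 := by
    intro f hf X hX
    rw [hker, Submodule.mem_dualCoannihilator] at hX
    exact hX _ (Submodule.mem_map_of_mem (hR (σ y) f hf))
  have hqsurj : Function.Surjective q := fun w => ⟨M w, by rw [hqM, hp]⟩
  have hpsurj : Function.Surjective p.toLinearMap := fun w => ⟨w, hp w⟩
  -- both kernels have codimension `dim W`
  have hkerq : p.ker = q.ker := by
    refine Submodule.eq_of_le_of_finrank_eq (fun X hX => ?_) ?_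
    · simp only [q, LinearMap.mem_ker, LinearMap.sum_apply, LinearMap.smulRight_apply]
      refine Finset.sum_eq_zero fun i _ => ?_
      have := hann (F i) (hF i) X hX
      exact (congrArg (fun t : ℂ => t • b i) this).trans (zero_smul _ _)
    · have h1 := p.toLinearMap.finrank_range_add_finrank_ker
      have h2 := q.finrank_range_add_finrank_ker
      rw [LinearMap.range_eq_top.2 hpsurj] at h1
      rw [LinearMap.range_eq_top.2 hqsurj] at h2
      have h3 : Module.finrank ℂ p.ker = Module.finrank ℂ p.toLinearMap.ker := rfl
      omega
  refine ⟨_, hcomp f, fun v hv => ?_⟩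
  have h4 : M v ∈ p.ker := by
    rw [hkerq, LinearMap.mem_ker, hqM]
    exact hv
  exact hann f hf _ h4

/-- A function of a space `R` stable under left translations is constant on the sets on which
finitely many suitable members of `R` are constant, locally near the identity. These members are the
coordinates on the cosets of the right stabilizer of `R`. -/
theorem exists_transverseCoordinates [FiniteDimensional ℂ E]
    {R : Submodule ℂ (HolomorphicFunctions E G)}
    (hR : ∀ g, ∀ f ∈ R, leftTranslate g f ∈ R) :
    ∃ (W : Submodule ℂ E) (c : TransverseCoordinates E (rightStabilizer R) W) (d : ℕ)
      (F : Fin d → HolomorphicFunctions E G), (∀ i, F i ∈ R) ∧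
        ∀ g h, (∀ i, F i g = F i h) → c.f g = c.f h := by
  have : CompleteSpace E := FiniteDimensional.complete ℂ E
  let 𝔫 : Submodule ℂ E := (R.map differentialOneₗ).dualCoannihilator
  obtain ⟨W, hW⟩ := 𝔫.exists_isCompl
  let p : E →L[ℂ] W := LinearMap.toContinuousLinearMap (W.projectionOnto 𝔫 hW.symm)
  have hp : ∀ w : W, p w = w := fun w => Submodule.projectionOnto_apply_left hW.symm w
  have hker : p.ker = 𝔫 := Submodule.ker_projectionOnto hW.symm
  let b := Module.finBasis ℂ W
  have hcoord : ∀ i, ∃ F ∈ R, ∀ X : E, F.differentialOne X = b.coord i (p X) := by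
    intro i
    have h1 : (b.coord i ∘ₗ p.toLinearMap) ∈ 𝔫.dualAnnihilator := by
      rw [Submodule.mem_dualAnnihilator]
      intro X hX
      have : p X = 0 := by rwa [← hker] at hX
      simp [this]
    rw [Subspace.dualCoannihilator_dualAnnihilator_eq] at h1
    obtain ⟨F, hF, hFe⟩ := h1
    exact ⟨F, hF, fun X => LinearMap.congr_fun hFe X⟩
  choose F hF hFd using hcoord
  let f : G → W := fun g => ∑ i, (F i g - F i 1) • b i
  have hf : ContMDiff 𝓘(ℂ, E) 𝓘(ℂ, W) ω f := by
    refine MDifferentiable.contMDiff_omega ?_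
    have h1 : ∀ i, MDifferentiable 𝓘(ℂ, E) 𝓘(ℂ, W) (fun g => (F i g - F i 1) • b i) := by
      intro i
      have h2 : Differentiable ℂ fun t : ℂ => (t - F i 1) • b i := by fun_prop
      exact h2.mdifferentiable.comp (F i).mdifferentiable
    have h3 : f = ∑ i, fun g => (F i g - F i 1) • b i := by
      funext g
      simp [f]
    rw [h3]
    exact MDifferentiable.sum fun i _ => h1 i
  have hfF : ∀ g i, F i g = b.coord i (f g) + F i 1 := by
    intro g i
    simp [f, Module.Basis.coord_apply, Finsupp.single_apply]
  -- straighten `f` in the chart at the identity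
  let e := extChartAt 𝓘(ℂ, E) (1 : G)
  have he1 : (1 : G) ∈ e.source := mem_extChartAt_source 1
  have hopen : IsOpen e.target := isOpen_extChartAt_target (1 : G)
  have hsymm : ContMDiffOn 𝓘(ℂ, E) 𝓘(ℂ, E) ω e.symm e.target := contMDiffOn_extChartAt_symm 1
  have hsymmat : ∀ z ∈ e.target, ContMDiffAt 𝓘(ℂ, E) 𝓘(ℂ, E) ω e.symm z := fun z hz =>
    hsymm.contMDiffAt (hopen.mem_nhds hz)
  have he1t : e 1 ∈ e.target := e.map_source he1
  have hφ : ContDiffAt ℂ ω (f ∘ e.symm) (e 1) :=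
    (ContMDiffAt.comp (e 1) (hf _) (hsymmat _ he1t)).contDiffAt
  have hφ' : HasFDerivAt (f ∘ e.symm) p (e 1) := by
    have h1 : ∀ i, HasFDerivAt (F i ∘ e.symm) ((F i).differentialOne) (e 1) := by
      intro i
      have h2 := (F i).hasMFDerivAt_differentialOne (y := (1 : G)) rfl
      have h3 : HasFDerivWithinAt (F i ∘ e.symm) (F i).differentialOne (Set.range 𝓘(ℂ, E)) (e 1) :=
        h2.2
      rwa [ModelWithCorners.range_eq_univ, hasFDerivWithinAt_univ] at h3
    have h4 : HasFDerivAt (fun z => ∑ i, ((F i ∘ e.symm) z - F i 1) • b i)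
        (∑ i, ((F i).differentialOne).smulRight (b i)) (e 1) :=
      HasFDerivAt.fun_sum fun i _ => ((h1 i).sub_const (F i 1)).smul_const (b i)
    convert! h4 using 1
    ext X
    simp only [sum_apply, ContinuousLinearMap.smulRight_apply, hFd]
    exact congrArg Subtype.val (b.sum_repr (p X)).symm
  have hφ1 : (f ∘ e.symm) (e 1) = 0 := by
    simp only [Function.comp_apply, e.left_inv he1]
    simp [f]
  obtain ⟨T, hT1, hT0, hpT, hTs⟩ := exists_straightening p hp hφ hφ' hφ1
  have hT0t : (0 : E) ∈ T.target := hT0 ▸ T.map_source hT1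
  have hTs0 : T.symm 0 = e 1 := by rw [← hT0, T.left_inv hT1]
  -- a product neighbourhood of `0` on which the coordinates are defined
  let B : ℝ → Set E := fun r => {z | ‖p z‖ < r ∧ ‖z - p z‖ < r}
  have hBopen : ∀ r, IsOpen (B r) := by
    intro r
    have h1 : Continuous fun z => ‖p z‖ := by fun_prop
    have h2 : Continuous fun z : E => ‖z - p z‖ := by fun_prop
    exact (isOpen_lt h1 continuous_const).inter (isOpen_lt h2 continuous_const)
  have hBconv : ∀ r, Convex ℝ (B r) := by
    intro r
    have h1 : B r = (p.restrictScalars ℝ) ⁻¹' Metric.ball 0 r ∩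
        (ContinuousLinearMap.id ℝ E - (W.subtypeL.comp p).restrictScalars ℝ) ⁻¹'
          Metric.ball 0 r := by
      ext z
      simp [B]
    rw [h1]
    exact ((convex_ball _ _).linear_preimage (p.restrictScalars ℝ).toLinearMap).inter
      ((convex_ball _ _).linear_preimage (ContinuousLinearMap.id ℝ E -
        (W.subtypeL.comp p).restrictScalars ℝ).toLinearMap)
  have hgood : ∀ᶠ y in 𝓝 (0 : E), y ∈ T.target ∧ T.symm y ∈ e.target ∧
      ContDiffAt ℂ ω T.symm y := by
    have h1 : ∀ᶠ y in 𝓝 (0 : E), T.symm y ∈ e.target :=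
      (T.continuousAt_symm hT0t).eventually (by rw [hTs0]; exact hopen.mem_nhds he1t)
    filter_upwards [T.open_target.mem_nhds hT0t, h1, hTs] with y h1 h2 h3 using ⟨h1, h2, h3⟩
  obtain ⟨r, hr, hrB⟩ : ∃ r > 0, ∀ y ∈ B r, y ∈ T.target ∧ T.symm y ∈ e.target ∧
      ContDiffAt ℂ ω T.symm y := by
    obtain ⟨ε, hε, h⟩ := Metric.eventually_nhds_iff_ball.1 hgood
    refine ⟨ε / 2, by positivity, fun y hy => h y ?_⟩
    rw [mem_ball_zero_iff]
    have h1 : y = (p y : E) + (y - p y) := by abel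
    rw [h1]
    refine (norm_add_le _ _).trans_lt ?_
    have h2 := hy.1
    have h3 := hy.2
    rw [← Submodule.coe_norm] at *
    linarith
  let U : Set G := e.source ∩ e ⁻¹' (T.source ∩ T ⁻¹' B r)
  have hU : IsOpen U :=
    (continuousOn_extChartAt (I := 𝓘(ℂ, E)) (1 : G)).isOpen_inter_preimage
      (isOpen_extChartAt_source (I := 𝓘(ℂ, E)) (1 : G))
      (T.continuousOn.isOpen_inter_preimage T.open_source (hBopen r))
  have hfU : ∀ g ∈ U, f g = p (T (e g)) := fun g hg => by
    rw [hpT, Function.comp_apply, e.left_inv hg.1]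
  let σ : E → G := fun y => e.symm (T.symm y)
  have hσ : ∀ y ∈ B r, ContMDiffAt 𝓘(ℂ, E) 𝓘(ℂ, E) ω σ y := by
    intro y hy
    obtain ⟨h1, h2, h3⟩ := hrB y hy
    exact (hsymmat _ h2).comp y h3.contMDiffAt
  have hTσ : ∀ y ∈ B r, σ y ∈ U ∧ T (e (σ y)) = y := by
    intro y hy
    obtain ⟨h1, h2, h3⟩ := hrB y hy
    have h4 : e (σ y) = T.symm y := e.right_inv h2
    refine ⟨⟨e.map_target h2, ?_⟩, ?_⟩
    · rw [Set.mem_preimage, h4]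
      exact ⟨T.map_target h1, by rwa [Set.mem_preimage, T.right_inv h1]⟩
    · rw [h4, T.right_inv h1]
  have hσT : ∀ g ∈ U, σ (T (e g)) = g := fun g hg => by
    simp only [σ]
    rw [T.left_inv hg.2.1, e.left_inv hg.1]
  have hfσ : ∀ y ∈ B r, f (σ y) = p y := fun y hy => by
    rw [hfU _ (hTσ y hy).1, (hTσ y hy).2]
  have hWB : ∀ w ∈ Metric.ball (0 : W) r, (w : E) ∈ B r := by
    intro w hw
    rw [mem_ball_zero_iff] at hw
    simpa [B, hp] using ⟨hw, hr⟩
  -- functions in `R` depend on `p` only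
  have hconst : ∀ h ∈ R, ∀ y ∈ B r, ∀ z ∈ B r, p y = p z → h (σ y) = h (σ z) := by
    intro h hh y hy z hz hyz
    have h1 : ∀ x ∈ B r, ∃ D : E →L[ℂ] ℂ, HasFDerivAt (h ∘ σ) D x ∧ ∀ v ∈ p.ker, D v = 0 := by
      intro x hx
      refine hasFDerivAt_apply_eq_zero hR b p hp hker hF ((hσ x hx).mdifferentiableAt (by simp))
        (fun i => F i 1) ?_ hh
      filter_upwards [(hBopen r).mem_nhds hx] with x' hx' i
      rw [hfF, hfσ x' hx']
    let l : ℝ → E := fun t => y + t • (z - y)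
    have hl : ∀ t ∈ Set.Icc (0 : ℝ) 1, l t ∈ B r := fun t ht =>
      (hBconv r).add_smul_sub_mem hy hz ht
    have hl' : ∀ t, HasDerivAt l (z - y) t := fun t => by
      have := ((hasDerivAt_id t).smul_const (z - y)).const_add y
      rwa [one_smul] at this
    have hzy : z - y ∈ p.ker := by
      rw [LinearMap.mem_ker]
      change p (z - y) = 0
      rw [map_sub, hyz, sub_self]
    have h2 : ∀ t ∈ Set.Icc (0 : ℝ) 1, HasDerivWithinAt (fun t => h (σ (l t))) 0
        (Set.Icc (0 : ℝ) 1) t := by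
      intro t ht
      obtain ⟨D, hD, hD0⟩ := h1 (l t) (hl t ht)
      have := ((hD.restrictScalars ℝ).comp_hasDerivAt t (hl' t)).hasDerivWithinAt
        (s := Set.Icc (0 : ℝ) 1)
      rwa [ContinuousLinearMap.coe_restrictScalars', hD0 _ hzy] at this
    have h3 := (convex_Icc (0 : ℝ) 1).norm_image_sub_le_of_norm_hasDerivWithin_le (C := 0) h2
      (fun t ht => by simp) (Set.left_mem_Icc.2 zero_le_one) (Set.right_mem_Icc.2 zero_le_one)
    simp only [l, zero_mul, norm_le_zero_iff, sub_eq_zero, zero_smul, one_smul, add_zero,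
      add_sub_cancel] at h3
    exact h3.symm
  refine ⟨W, ⟨f, fun w => σ w, U, r, hf, ?_, hU, ?_, ?_, ?_, ?_, ?_, ?_⟩, _, F, hF,
    fun g h hgh => show f g = f h by simp only [f, hgh]⟩
  · intro x n hn
    simp only [f]
    exact Finset.sum_congr rfl fun i _ => by rw [mem_rightStabilizer.1 hn _ (hF i)]
  · refine ⟨he1, hT1, ?_⟩
    rw [Set.mem_preimage, hT0]
    simpa [B] using hr
  · intro g hg
    rw [hfU g hg, mem_ball_zero_iff]
    exact hg.2.2.1
  · exact fun w hw => (hTσ _ (hWB w hw)).1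
  · exact fun w hw => by rw [hfσ _ (hWB w hw), hp]
  · intro w hw
    exact ((hσ _ (hWB w hw)).comp w
      (W.subtypeL.contDiff.contMDiff.contMDiffAt)).contMDiffWithinAt
  · intro g hg h hh hgh u hu x
    have h1 := hconst (leftTranslate (x * g⁻¹) u) (hR _ u hu) (T (e h)) hh.2.2 (T (e g)) hg.2.2
      (by rw [← hfU g hg, ← hfU h hh, hgh])
    rw [hσT g hg, hσT h hh] at h1
    simpa [mul_assoc] using h1

end Transverse

/-! ### Quotient Lie groups -/

namespace TransverseCoordinates

variable {E : Type u} [NormedAddCommGroup E] [NormedSpace ℂ E]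
  {G : Type u} [TopologicalSpace G] [ChartedSpace E G] [Group G]
  {N : Subgroup G} {W : Type u} [NormedAddCommGroup W] [NormedSpace ℂ W]
  (c : TransverseCoordinates E N W)

/-- The coordinate map on `G ⧸ N`, centred at the coset of `x`. -/
def quotientMap (x : G) : G ⧸ N → W :=
  Quotient.lift (fun g => c.f (x⁻¹ * g)) fun a b hab => by
    have h : a⁻¹ * b ∈ N := QuotientGroup.leftRel_apply.1 hab
    simpa [mul_assoc] using (c.f_mul (x⁻¹ * a) _ h).symm

@[simp] theorem quotientMap_mk (x g : G) : c.quotientMap x (g : G ⧸ N) = c.f (x⁻¹ * g) := rfl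

theorem mk_mul_s_f (x : G) {g : G} (hg : g ∈ c.U) :
    ((x * c.s (c.f g) : G) : G ⧸ N) = ((x * g : G) : G ⧸ N) := by
  have hs := c.f_mem g hg
  rw [QuotientGroup.eq]
  simpa [mul_assoc] using c.inv_mul_mem _ (c.s_mem _ hs) g hg (c.f_s _ hs)

variable [LieGroup 𝓘(ℂ, E) ω G]

/-- The chart of `G ⧸ N` centred at the coset of `x`. -/
def chart (x : G) : OpenPartialHomeomorph (G ⧸ N) W where
  toFun := c.quotientMap x
  invFun w := ((x * c.s w : G) : G ⧸ N)
  source := (fun g : G => ((x * g : G) : G ⧸ N)) '' c.U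
  target := Metric.ball 0 c.r
  map_source' := by
    rintro _ ⟨g, hg, rfl⟩
    simpa using c.f_mem g hg
  map_target' w hw := ⟨c.s w, c.s_mem w hw, rfl⟩
  left_inv' := by
    rintro _ ⟨g, hg, rfl⟩
    simpa using c.mk_mul_s_f x hg
  right_inv' w hw := by simpa using c.f_s w hw
  open_source := by
    have hG : IsTopologicalGroup G := topologicalGroup_of_lieGroup 𝓘(ℂ, E) ω
    exact (QuotientGroup.isOpenMap_coe.comp (isOpenMap_mul_left x)) _ c.isOpen_U
  open_target := Metric.isOpen_ball
  continuousOn_toFun := by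
    have hG : IsTopologicalGroup G := topologicalGroup_of_lieGroup 𝓘(ℂ, E) ω
    refine Continuous.continuousOn (Continuous.quotient_lift ?_ _)
    exact c.contMDiff_f.continuous.comp (continuous_const_mul x⁻¹)
  continuousOn_invFun := by
    have hG : IsTopologicalGroup G := topologicalGroup_of_lieGroup 𝓘(ℂ, E) ω
    exact (QuotientGroup.continuous_mk.comp (continuous_const_mul x)).comp_continuousOn
      c.contMDiffOn_s.continuousOn

theorem chart_apply (x : G) (q : G ⧸ N) : c.chart x q = c.quotientMap x q := rfl

theorem chart_symm_apply (x : G) (w : W) :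
    (c.chart x).symm w = ((x * c.s w : G) : G ⧸ N) := rfl

theorem mk_mem_chart_source (x : G) : (x : G ⧸ N) ∈ (c.chart x).source :=
  ⟨1, c.one_mem_U, by simp⟩

/-- The structure of a manifold modelled on `W` on the quotient `G ⧸ N`. -/
@[reducible] def chartedSpace : ChartedSpace W (G ⧸ N) where
  atlas := Set.range c.chart
  chartAt q := c.chart q.out
  mem_chart_source q := by
    have := c.mk_mem_chart_source q.out
    rwa [QuotientGroup.out_eq'] at this
  chart_mem_atlas q := ⟨_, rfl⟩

theorem contMDiff_f_mul (x : G) : ContMDiff 𝓘(ℂ, E) 𝓘(ℂ, W) ω fun g : G => c.f (x * g) :=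
  c.contMDiff_f.comp (contMDiff_mul_left (a := x))

theorem isManifold : letI := c.chartedSpace; IsManifold 𝓘(ℂ, W) ω (G ⧸ N) := by
  let _ := c.chartedSpace
  refine isManifold_of_contDiffOn _ _ _ ?_
  rintro _ _ ⟨x, rfl⟩ ⟨y, rfl⟩
  have h1 : ContMDiffOn 𝓘(ℂ, W) 𝓘(ℂ, W) ω (fun w => c.f (y⁻¹ * x * c.s w)) (Metric.ball 0 c.r) :=
    (c.contMDiff_f_mul (y⁻¹ * x)).comp_contMDiffOn c.contMDiffOn_s
  refine (h1.contDiffOn.congr fun w hw => ?_).mono ?_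
  · simp [chart_apply, chart_symm_apply, mul_assoc]
  · intro w hw
    exact hw.1.1

/-- The projection to the quotient is holomorphic. -/
theorem contMDiff_mk : letI := c.chartedSpace;
    ContMDiff 𝓘(ℂ, E) 𝓘(ℂ, W) ω (fun g : G => (g : G ⧸ N)) := by
  let _ := c.chartedSpace
  intro g
  rw [contMDiffAt_iff_target]
  refine ⟨QuotientGroup.continuous_mk.continuousAt, ?_⟩
  exact c.contMDiff_f_mul ((g : G ⧸ N).out)⁻¹ g

/-- The projection to the quotient has local holomorphic sections. -/
theorem exists_section (q : G ⧸ N) : letI := c.chartedSpace;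
    ∃ σ : G ⧸ N → G, ContMDiffAt 𝓘(ℂ, W) 𝓘(ℂ, E) ω σ q ∧ ∀ᶠ q' in 𝓝 q, (σ q' : G ⧸ N) = q' := by
  let _ := c.chartedSpace
  have := c.isManifold
  let x := q.out
  have hq : q ∈ (chartAt W q).source := mem_chart_source W q
  have hchart : ContMDiffAt 𝓘(ℂ, W) 𝓘(ℂ, W) ω (chartAt W q) q := contMDiffAt_of_mem_maximalAtlas
    (IsManifold.chart_mem_maximalAtlas q) hq
  have hs : ContMDiffAt 𝓘(ℂ, W) 𝓘(ℂ, E) ω c.s (chartAt W q q) :=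
    c.contMDiffOn_s.contMDiffAt (Metric.isOpen_ball.mem_nhds ((chartAt W q).map_source hq))
  refine ⟨fun q' => x * c.s (chartAt W q q'), ?_, ?_⟩
  · exact (contMDiff_mul_left (a := x)).contMDiffAt.comp q (hs.comp q hchart)
  · filter_upwards [(chartAt W q).open_source.mem_nhds hq] with q' hq'
    exact (chartAt W q).left_inv hq'

/-- The quotient of a complex Lie group by a normal subgroup with transverse coordinates is a
complex Lie group. -/
theorem lieGroup [N.Normal] : letI := c.chartedSpace; LieGroup 𝓘(ℂ, W) ω (G ⧸ N) := by
  let _ := c.chartedSpace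
  have := c.isManifold
  refine { contMDiff_mul := ?_, contMDiff_inv := ?_ }
  · rintro ⟨q₁, q₂⟩
    obtain ⟨σ₁, h₁, h₁'⟩ := c.exists_section q₁
    obtain ⟨σ₂, h₂, h₂'⟩ := c.exists_section q₂
    have h3 : ContMDiffAt (𝓘(ℂ, W).prod 𝓘(ℂ, W)) 𝓘(ℂ, E) ω
        (fun p : (G ⧸ N) × (G ⧸ N) => σ₁ p.1 * σ₂ p.2) (q₁, q₂) :=
      (h₁.comp (q₁, q₂) contMDiffAt_fst).mul (h₂.comp (q₁, q₂) contMDiffAt_snd)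
    refine (c.contMDiff_mk.contMDiffAt.comp (q₁, q₂) h3).congr_of_eventuallyEq ?_
    rw [nhds_prod_eq]
    filter_upwards [h₁'.prod_mk h₂'] with p hp
    simp only [Function.comp_apply, QuotientGroup.mk_mul, hp.1, hp.2]
  · intro q
    obtain ⟨σ, h, h'⟩ := c.exists_section q
    refine (c.contMDiff_mk.contMDiffAt.comp q h.inv).congr_of_eventuallyEq ?_
    filter_upwards [h'] with p hp
    simp only [Function.comp_apply, QuotientGroup.mk_inv, hp]

end TransverseCoordinates

/-! ### Holomorphic functions invariant under `K` are constant -/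

namespace IsUniversalComplexification

open HolomorphicFunctions AnalyticFunctional

variable {F : Type u} [NormedAddCommGroup F] [NormedSpace ℝ F]
  {K : Type u} [TopologicalSpace K] [ChartedSpace F K] [Group K] [LieGroup 𝓘(ℝ, F) ∞ K]
  [CompactSpace K] [T2Space K]
  {E : Type u} [NormedAddCommGroup E] [NormedSpace ℂ E] [FiniteDimensional ℂ E]
  {G : Type u} [TopologicalSpace G] [ChartedSpace E G] [Group G] [LieGroup 𝓘(ℂ, E) ω G]
  {η : K →* G}

/-- The stabilizer of the functions that are locally constant along `K` is open: it is normal, the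
quotient by it is a complex Lie group in which the image of `K` is finite, and so the quotient is
finite. -/
theorem isOpen_rightStabilizer (hη : IsUniversalComplexification F E η) :
    IsOpen (rightStabilizer (locallyInvariant E η) : Set G) := by
  have hG : IsTopologicalGroup G := topologicalGroup_of_lieGroup 𝓘(ℂ, E) ω
  have hK : IsTopologicalGroup K := topologicalGroup_of_lieGroup 𝓘(ℝ, F) ∞
  let N := rightStabilizer (locallyInvariant E η)
  have hnormal : N.Normal := by
    refine ⟨fun n hn g f hf x => ?_⟩
    have := hn _ (hη.rightTranslate_mem_locallyInvariant hf g⁻¹) (x * g)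
    simpa [mul_assoc] using this
  have hclosed : IsClosed (N : Set G) := by
    have h1 : (N : Set G) = ⋂ f ∈ locallyInvariant E η, ⋂ x, {n | f (x * n) = f x} := by
      ext n
      simp [N, mem_rightStabilizer]
    rw [h1]
    refine isClosed_biInter fun f _ => isClosed_iInter fun x => ?_
    exact isClosed_eq (f.continuous.comp (continuous_const_mul x)) continuous_const
  obtain ⟨W, c, d, f, hf, hfc⟩ := exists_transverseCoordinates
    (R := locallyInvariant E η) fun g f hf => leftTranslate_mem_locallyInvariant hf g
  let _ : ChartedSpace W (G ⧸ N) := c.chartedSpace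
  have hlie : LieGroup 𝓘(ℂ, W) ω (G ⧸ N) := c.lieGroup
  have hloc : IsLocallyConstant fun k => QuotientGroup.mk' N (η k) := by
    refine ((QuotientGroup.mk' N).comp η).isLocallyConstant_of_eventually_eq_one ?_
    have h1 : ∀ᶠ k in 𝓝 (1 : K), η k ∈ c.U :=
      hη.contMDiff.continuous.continuousAt.eventually
        (c.isOpen_U.mem_nhds (by rw [map_one]; exact c.one_mem_U))
    have h2 : ∀ᶠ k in 𝓝 (1 : K), ∀ i, f i (η k) = f i 1 := by
      refine Filter.eventually_all.2 fun i => ?_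
      filter_upwards [(hf i 1).eventually_eq 1] with k hk
      simpa using hk
    filter_upwards [h1, h2] with k hk1 hk2
    have h3 := c.inv_mul_mem 1 c.one_mem_U (η k) hk1 (hfc _ _ hk2).symm
    rw [inv_one, one_mul] at h3
    exact (QuotientGroup.eq_one_iff _).2 h3
  have hsurj : Function.Surjective fun g : G => (g : G ⧸ N) := QuotientGroup.mk_surjective
  have hfin : Finite (G ⧸ N) := by
    refine Set.finite_univ_iff.1 (hloc.range_finite.subset fun q _ => ?_)
    obtain ⟨g, rfl⟩ := hsurj q
    exact hη.exists_eq_of_isLocallyConstant (E' := W) (π := QuotientGroup.mk' N)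
      (c.contMDiff_mk.mdifferentiable (by simp)) hloc g
  have hindex : N.FiniteIndex := N.finiteIndex_of_finite_quotient
  exact N.isOpen_of_isClosed_of_finiteIndex hclosed

/-- A holomorphic function on `G` that is invariant under right translations by `K` is constant. -/
theorem apply_eq_apply_one (hη : IsUniversalComplexification F E η) (f : HolomorphicFunctions E G)
    (hf : ∀ x k, f (x * η k) = f x) (g : G) : f g = f 1 := by
  have hG : IsTopologicalGroup G := topologicalGroup_of_lieGroup 𝓘(ℂ, E) ω
  have hmem : f ∈ locallyInvariant E η := fun x => by
    simp only [hf]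
    exact IsLocallyConstant.const (f x)
  have hloc : IsLocallyConstant f := by
    rw [IsLocallyConstant.iff_eventually_eq]
    intro x
    have h1 : ∀ᶠ y in 𝓝 x, x⁻¹ * y ∈ rightStabilizer (locallyInvariant E η) :=
      (continuous_const_mul x⁻¹).continuousAt.eventually
        (hη.isOpen_rightStabilizer.mem_nhds (by simp [one_mem]))
    filter_upwards [h1] with y hy
    simpa using hy f hmem x
  obtain ⟨k, hk⟩ := hη.exists_mem_connectedComponent g
  rw [← hloc.apply_eq_of_isPreconnected isPreconnected_connectedComponent hk mem_connectedComponent,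
    ← hf (g * (η k)⁻¹) k, inv_mul_cancel_right]

end IsUniversalComplexification

/-! ### Bounded sets of holomorphic functions -/

open Bornology

namespace HolomorphicFunctions

variable {E : Type*} [NormedAddCommGroup E] [NormedSpace ℂ E]
  {M : Type*} [TopologicalSpace M] [ChartedSpace E M]

theorem hasBasis_nhds_zero : (𝓝 (0 : HolomorphicFunctions E M)).HasBasis
    (fun p : Set M × ℝ => IsCompact p.1 ∧ 0 < p.2) fun p => {f | ∀ x ∈ p.1, ‖f x‖ < p.2} := by
  have h1 := ((Metric.nhds_basis_ball (x := (0 : ℂ))).nhds_continuousMapConst (X := M)).comap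
    (toContinuousMap : HolomorphicFunctions E M → C(M, ℂ))
  rw [isInducing_toContinuousMap.nhds_eq_comap, map_zero]
  convert! h1 using 1
  ext p f
  simp [Set.MapsTo]

/-- A set of holomorphic functions is bounded if and only if it is uniformly bounded on every
compact set. -/
theorem isVonNBounded_iff {B : Set (HolomorphicFunctions E M)} :
    IsVonNBounded ℂ B ↔ ∀ L : Set M, IsCompact L → ∃ C, ∀ f ∈ B, ∀ x ∈ L, ‖f x‖ ≤ C := by
  constructor
  · intro hB L hL
    obtain ⟨r, hr⟩ := absorbs_iff_norm.1 (hB (hasBasis_nhds_zero.mem_of_mem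
      (i := (L, (1 : ℝ))) ⟨hL, one_pos⟩))
    refine ⟨‖((|r| : ℝ) : ℂ)‖, fun f hf x hx => ?_⟩
    obtain ⟨g, hg, rfl⟩ := hr ((|r| : ℝ) : ℂ) (by simpa using le_abs_self r) hf
    rw [smul_apply, norm_mul]
    exact mul_le_of_le_one_right (norm_nonneg _) (hg x hx).le
  · intro h
    refine hasBasis_nhds_zero.isVonNBounded_iff.2 ?_
    rintro ⟨L, ε⟩ ⟨hL, hε⟩
    simp only at hL hε
    obtain ⟨C, hC⟩ := h L hL
    refine absorbs_iff_norm.2 ⟨(|C| + 1) / ε, fun c hc f hf => ?_⟩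
    have hc0 : 0 < ‖c‖ := lt_of_lt_of_le (by positivity) hc
    refine ⟨c⁻¹ • f, fun x hx => ?_, smul_inv_smul₀ (norm_pos_iff.1 hc0) f⟩
    rw [smul_apply, norm_mul, norm_inv, inv_mul_lt_iff₀ hc0]
    rw [div_le_iff₀ hε] at hc
    linarith [hC f hf x hx, le_abs_self C]

theorem _root_.Bornology.IsVonNBounded.exists_norm_apply_le {B : Set (HolomorphicFunctions E M)}
    (hB : IsVonNBounded ℂ B) {L : Set M} (hL : IsCompact L) :
    ∃ C, 0 < C ∧ ∀ f ∈ B, ∀ x ∈ L, ‖f x‖ ≤ C := by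
  obtain ⟨C, hC⟩ := isVonNBounded_iff.1 hB L hL
  exact ⟨max C 1, lt_max_of_lt_right one_pos,
    fun f hf x hx => (hC f hf x hx).trans (le_max_left _ _)⟩

/-- A bounded set of holomorphic functions is equicontinuous. -/
theorem eventually_norm_sub_le [FiniteDimensional ℂ E] [IsManifold 𝓘(ℂ, E) 1 M]
    {B : Set (HolomorphicFunctions E M)} (hB : IsVonNBounded ℂ B) (x : M) {ε : ℝ} (hε : 0 < ε) :
    ∀ᶠ y in 𝓝 x, ∀ f ∈ B, ‖f y - f x‖ ≤ ε := by
  have : ProperSpace E := FiniteDimensional.proper ℂ E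
  let e := extChartAt 𝓘(ℂ, E) x
  have hopen : IsOpen e.target := isOpen_extChartAt_target x
  have hsymm : MDifferentiableOn 𝓘(ℂ, E) 𝓘(ℂ, E) e.symm e.target :=
    (contMDiffOn_extChartAt_symm (n := 1) x).mdifferentiableOn one_ne_zero
  obtain ⟨R, hR, hball⟩ := Metric.nhds_basis_closedBall.mem_iff.1
    (hopen.mem_nhds (mem_extChartAt_target (I := 𝓘(ℂ, E)) x))
  have hball' : Metric.ball (e x) R ⊆ e.target := Metric.ball_subset_closedBall.trans hball
  obtain ⟨C, hC, hBC⟩ := hB.exists_norm_apply_le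
    ((isCompact_closedBall (e x) R).image_of_continuousOn (hsymm.continuousOn.mono hball))
  have hlip : ∀ f ∈ B, ∀ z ∈ Metric.ball (e x) R, ‖f (e.symm z) - f x‖ ≤ 2 * C / R * ‖z - e x‖ := by
    intro f hf z hz
    have hd : DifferentiableOn ℂ (f ∘ e.symm) (Metric.ball (e x) R) := by
      rw [← mdifferentiableOn_iff_differentiableOn]
      exact f.mdifferentiable.comp_mdifferentiableOn (hsymm.mono hball')
    have hb : ∀ z ∈ Metric.ball (e x) R, ‖(f ∘ e.symm) z‖ ≤ C := fun z hz =>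
      hBC f hf _ ⟨z, Metric.ball_subset_closedBall hz, rfl⟩
    have h1 := Complex.dist_le_div_mul_dist_of_mapsTo_ball hd (R₂ := 2 * C) (fun w hw => by
      rw [mem_closedBall_iff_norm]
      linarith [norm_sub_le ((f ∘ e.symm) w) ((f ∘ e.symm) (e x)), hb w hw,
        hb _ (Metric.mem_ball_self hR)]) hz
    simpa [dist_eq_norm_sub, e.left_inv (mem_extChartAt_source (I := 𝓘(ℂ, E)) x)] using h1
  have h2 : ∀ᶠ y in 𝓝 x, e y ∈ Metric.ball (e x) (min R (ε * R / (2 * C))) :=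
    (continuousAt_extChartAt (I := 𝓘(ℂ, E)) x).eventually (Metric.ball_mem_nhds _ (by positivity))
  filter_upwards [h2, extChartAt_source_mem_nhds (I := 𝓘(ℂ, E)) x] with y hy hys f hf
  have h3 := hlip f hf (e y) (Metric.ball_subset_ball (min_le_left _ _) hy)
  rw [e.left_inv hys] at h3
  refine h3.trans ?_
  have h4 : ‖e y - e x‖ ≤ ε * R / (2 * C) :=
    ((mem_ball_iff_norm.1 hy).trans_le (min_le_right _ _)).le
  calc _ ≤ 2 * C / R * (ε * R / (2 * C)) := by gcongr
    _ = ε := by field_simp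

instance [WeaklyLocallyCompactSpace M] [SigmaCompactSpace M] :
    FirstCountableTopology (HolomorphicFunctions E M) :=
  isInducing_toContinuousMap.firstCountableTopology

end HolomorphicFunctions

/-! ### The locally convex space of analytic functionals -/

namespace AnalyticFunctional

section Space

variable {E : Type*} [NormedAddCommGroup E] [NormedSpace ℂ E]
  {M : Type*} [TopologicalSpace M] [ChartedSpace E M]

instance : IsUniformAddGroup (AnalyticFunctional E M) :=
  inferInstanceAs (IsUniformAddGroup (StrongDual ℂ (HolomorphicFunctions E M)))

instance : ContinuousSMul ℂ (AnalyticFunctional E M) :=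
  inferInstanceAs (ContinuousSMul ℂ (StrongDual ℂ (HolomorphicFunctions E M)))

instance : T2Space (AnalyticFunctional E M) :=
  inferInstanceAs (T2Space (StrongDual ℂ (HolomorphicFunctions E M)))

instance : LocallyConvexSpace ℝ (AnalyticFunctional E M) :=
  inferInstanceAs (LocallyConvexSpace ℝ (StrongDual ℂ (HolomorphicFunctions E M)))

instance [WeaklyLocallyCompactSpace M] [SigmaCompactSpace M] :
    CompleteSpace (AnalyticFunctional E M) :=
  inferInstanceAs (CompleteSpace (StrongDual ℂ (HolomorphicFunctions E M)))

instance [WeaklyLocallyCompactSpace M] [SigmaCompactSpace M] :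
    IsCompleteLocallyConvex (AnalyticFunctional E M) where

/-- The polars of the bounded sets form a basis of neighbourhoods of zero. -/
theorem hasBasis_nhds_zero : (𝓝 (0 : AnalyticFunctional E M)).HasBasis
    (fun B : Set (HolomorphicFunctions E M) => IsVonNBounded ℂ B)
    fun B => {α | ∀ f ∈ B, ‖α f‖ ≤ 1} := by
  have h : (𝓝 (0 : AnalyticFunctional E M)).HasBasis
      (fun SV : Set (HolomorphicFunctions E M) × Set ℂ => IsVonNBounded ℂ SV.1 ∧ SV.2 ∈ 𝓝 0)
      fun SV => {α | ∀ f ∈ SV.1, α f ∈ SV.2} :=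
    ContinuousLinearMap.hasBasis_nhds_zero (E := HolomorphicFunctions E M) (F := ℂ)
      (σ := RingHom.id ℂ)
  refine h.to_hasBasis ?_ fun B hB => ⟨(B, Metric.closedBall 0 1),
    ⟨hB, Metric.closedBall_mem_nhds _ one_pos⟩, fun α hα f hf => by simpa using hα f hf⟩
  rintro ⟨S, V⟩ ⟨hS, hV⟩
  obtain ⟨ε, hε, hεV⟩ := Metric.mem_nhds_iff.1 hV
  let c : ℂ := ((2 / ε : ℝ) : ℂ)
  refine ⟨_, hS.image (c • ContinuousLinearMap.id ℂ (HolomorphicFunctions E M)),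
    fun α hα f hf => ?_⟩
  apply hεV
  have h1 : ‖α (c • f)‖ ≤ 1 := hα _ ⟨f, hf, rfl⟩
  rw [map_smul, norm_smul, Complex.norm_real, Real.norm_of_nonneg (by positivity)] at h1
  rw [mem_ball_zero_iff]
  rw [div_mul_eq_mul_div, div_le_one hε] at h1
  linarith [norm_nonneg (α f)]

theorem exists_norm_apply_le_of_isVonNBounded (α : AnalyticFunctional E M)
    {B : Set (HolomorphicFunctions E M)}
    (hB : IsVonNBounded ℂ B) : ∃ C, 0 < C ∧ ∀ f ∈ B, ‖α f‖ ≤ C := by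
  have h1 := NormedSpace.isVonNBounded_iff ℂ |>.1
    (hB.image (α : StrongDual ℂ (HolomorphicFunctions E M)))
  obtain ⟨C, hC⟩ := h1.exists_norm_le
  exact ⟨max C 1, lt_max_of_lt_right one_pos,
    fun f hf => (hC _ ⟨f, hf, rfl⟩).trans (le_max_left _ _)⟩

/-- The map `x ↦ δ_x` is continuous. -/
theorem continuous_delta [FiniteDimensional ℂ E] [IsManifold 𝓘(ℂ, E) 1 M] :
    Continuous (delta : M → AnalyticFunctional E M) := by
  rw [continuous_iff_continuousAt]
  intro x
  rw [ContinuousAt, ← tendsto_sub_nhds_zero_iff, hasBasis_nhds_zero.tendsto_right_iff]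
  intro B hB
  filter_upwards [HolomorphicFunctions.eventually_norm_sub_le hB x one_pos] with y hy
  exact hy

/-- The linear span of the functionals `δ_x` is dense. Indeed an analytic functional extends to a
functional on `C(M, ℂ)`, and on a bounded set of holomorphic functions, which is equicontinuous,
it is approximated by finite sums of point evaluations with weights from a partition of unity. -/
theorem mem_closure_span_delta [FiniteDimensional ℂ E] [IsManifold 𝓘(ℂ, E) 1 M] [T2Space M]
    [LocallyCompactSpace M] (α : AnalyticFunctional E M) :
    α ∈ closure (Submodule.span ℂ (Set.range (delta : M → AnalyticFunctional E M)) :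
      Set (AnalyticFunctional E M)) := by
  have hbasis : (𝓝 α).HasBasis (fun B : Set (HolomorphicFunctions E M) => IsVonNBounded ℂ B)
      fun B => {β | ∀ f ∈ B, ‖(β - α) f‖ ≤ 1} := by
    have h1 := (hasBasis_nhds_zero (E := E) (M := M)).comap (· - α)
    simp only [sub_eq_add_neg, nhds_translation_add_neg] at h1
    exact h1.to_hasBasis (fun B hB => ⟨B, hB, fun β hβ f hf => by
      simpa only [← sub_eq_add_neg] using hβ f hf⟩) fun B hB => ⟨B, hB, fun β hβ f hf => by
      simpa only [← sub_eq_add_neg] using hβ f hf⟩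
  rw [mem_closure_iff_nhds_basis hbasis]
  intro B hB
  obtain ⟨γ, hγ⟩ := exists_extension α
  obtain ⟨L, C, hL, hC, hγC⟩ := exists_isCompact_bound γ
  have hε : 0 < 1 / C := by positivity
  choose s hs using fun x : M => mem_nhds_iff.1
    (HolomorphicFunctions.eventually_norm_sub_le hB x hε)
  obtain ⟨t, ht⟩ := hL.elim_finite_subcover s (fun x => (hs x).2.1)
    fun x _ => Set.mem_iUnion.2 ⟨x, (hs x).2.2⟩
  let x : Fin t.card → M := fun i => t.equivFin.symm i
  obtain ⟨ρ, hρs, hρ1, hρ01, -⟩ := exists_continuous_sum_one_of_isOpen_isCompact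
    (s := fun i => s (x i)) (fun i => (hs (x i)).2.1) hL (fun y hy => by
      obtain ⟨z, hz, hyz⟩ := Set.mem_iUnion₂.1 (ht hy)
      exact Set.mem_iUnion.2 ⟨t.equivFin ⟨z, hz⟩, by simpa [x] using hyz⟩)
  let ρ' : Fin t.card → C(M, ℂ) := fun i => ⟨fun y => (ρ i y : ℂ), by fun_prop⟩
  refine ⟨∑ i, γ (ρ' i) • delta (x i), Submodule.sum_mem _ fun i _ =>
    Submodule.smul_mem _ _ (Submodule.subset_span ⟨_, rfl⟩), fun f hf => ?_⟩
  have h1 : ((∑ i, γ (ρ' i) • delta (x i)) - α : AnalyticFunctional E M) f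
      = γ (∑ i, f (x i) • ρ' i - f.toContinuousMap) := by
    have h2 : (∑ i, γ (ρ' i) • delta (x i) : AnalyticFunctional E M) f
        = ∑ i, γ (ρ' i) * f (x i) := by
      have : ∀ u : Finset (Fin t.card), (∑ i ∈ u, γ (ρ' i) • delta (x i) : AnalyticFunctional E M) f
          = ∑ i ∈ u, γ (ρ' i) * f (x i) := by
        intro u
        induction u using Finset.cons_induction with
        | empty => rfl
        | cons a u ha ih => rw [Finset.sum_cons, Finset.sum_cons, add_apply, ih]; rfl
      exact this _
    have h3 : ∀ β : AnalyticFunctional E M, (β - α) f = β f - α f := fun β => rfl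
    rw [h3, h2, map_sub, hγ, map_sum]
    simp [mul_comm]
  rw [h1]
  refine (hγC _ (1 / C) hε fun y hy => ?_).trans (by field_simp; rfl)
  have hy1 : ∑ i, (ρ i y : ℂ) = 1 := by
    have := hρ1 hy
    simp only [Finset.sum_apply, Pi.one_apply] at this
    exact_mod_cast this
  have h4 : (∑ i, f (x i) • ρ' i - f.toContinuousMap) y = ∑ i, (ρ i y : ℂ) * (f (x i) - f y) := by
    simp only [mul_sub, Finset.sum_sub_distrib, ← Finset.sum_mul, hy1, one_mul]
    simp [ρ', mul_comm]
  rw [h4]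
  refine (norm_sum_le _ _).trans ?_
  calc _ ≤ ∑ i, ρ i y * (1 / C) := by
        refine Finset.sum_le_sum fun i _ => ?_
        rw [norm_mul, Complex.norm_real, Real.norm_of_nonneg (hρ01 i y).1]
        by_cases h0 : ρ i y = 0
        · simp [h0]
        · have h5 : y ∈ s (x i) := hρs i (subset_tsupport _ h0)
          rw [norm_sub_rev]
          exact mul_le_mul_of_nonneg_left ((hs (x i)).1 h5 f hf) (hρ01 i y).1
    _ = 1 / C := by
        rw [← Finset.sum_mul]
        have : ∑ i, ρ i y = 1 := by exact_mod_cast hy1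
        rw [this, one_mul]

/-- A closed condition on analytic functionals that is stable under linear combinations holds for
all of them if it holds for the functionals `δ_x`. -/
theorem eq_zero_of_delta [FiniteDimensional ℂ E] [IsManifold 𝓘(ℂ, E) 1 M] [T2Space M]
    [LocallyCompactSpace M] {X : Type*} [AddCommGroup X] [Module ℂ X] [TopologicalSpace X]
    [T1Space X] (T : AnalyticFunctional E M →L[ℂ] X) (hT : ∀ x, T (delta x) = 0) : T = 0 := by
  ext α
  have hclosed : IsClosed {α | T α = 0} := isClosed_singleton.preimage T.continuous
  refine hclosed.closure_subset_iff.2 (fun β hβ => ?_) (mem_closure_span_delta α)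
  have : Submodule.span ℂ (Set.range delta) ≤ LinearMap.ker T.toLinearMap := by
    rw [Submodule.span_le]
    rintro _ ⟨x, rfl⟩
    exact hT x
  exact this hβ

end Space

end AnalyticFunctional

/-! ### Joint continuity of convolution -/

namespace AnalyticFunctional

section Multiplication

/-- The estimate for `α` on the functions dominated by a weight scales to the multiples of the
weight. -/
theorem norm_apply_le_mul {E : Type*} [NormedAddCommGroup E] [NormedSpace ℂ E]
    {M : Type*} [TopologicalSpace M] [ChartedSpace E M] {α : AnalyticFunctional E M}
    {w : M → ℝ} {a : ℝ}
    (hα : ∀ f : HolomorphicFunctions E M, (∀ x, ‖f x‖ ≤ w x) → ‖α f‖ ≤ a)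
    {f : HolomorphicFunctions E M} {c : ℝ} (hc : 0 ≤ c) (hf : ∀ x, ‖f x‖ ≤ w x * c) :
    ‖α f‖ ≤ a * c := by
  rcases hc.eq_or_lt with rfl | hc
  · have : f = 0 := HolomorphicFunctions.ext fun x => by
      have := hf x
      rw [mul_zero] at this
      exact norm_le_zero_iff.1 this
    simp [this]
  · have h1 := hα ((c : ℂ)⁻¹ • f) fun x => by
      rw [HolomorphicFunctions.smul_apply, norm_mul, norm_inv, Complex.norm_real,
        Real.norm_of_nonneg hc.le, inv_mul_le_iff₀ hc, mul_comm]
      exact hf x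
    rwa [map_smul, norm_smul, norm_inv, Complex.norm_real,
        Real.norm_of_nonneg hc.le, inv_mul_le_iff₀ hc, mul_comm] at h1

variable {E : Type*} [NormedAddCommGroup E] [NormedSpace ℂ E]
  {G : Type*} [TopologicalSpace G] [ChartedSpace E G] [Group G]

/-- A bounded set of functions on a group that is countable at infinity is dominated, after
pulling back along the multiplication, by a product of two copies of one locally bounded weight. -/
theorem _root_.Bornology.IsVonNBounded.exists_weight [ContinuousMul G]
    [WeaklyLocallyCompactSpace G] [SigmaCompactSpace G] {B : Set (HolomorphicFunctions E G)}
    (hB : IsVonNBounded ℂ B) :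
    ∃ w : G → ℝ, (∀ g, 0 < w g) ∧ (∀ L, IsCompact L → ∃ C, ∀ g ∈ L, w g ≤ C) ∧
      ∀ f ∈ B, ∀ g h, ‖f (g * h)‖ ≤ w g * w h := by
  let X : CompactExhaustion G := CompactExhaustion.choice G
  have hX : ∀ n, IsCompact ((fun p : G × G => p.1 * p.2) '' (X n ×ˢ X n)) := fun n =>
    ((X.isCompact n).prod (X.isCompact n)).image continuous_mul
  choose C hC hBC using fun n => hB.exists_norm_apply_le (hX n)
  -- a monotone majorant of `C` with values at least `1`, so that
  -- `C (max m n) ≤ max (c m) (c n) ≤ c m * c n`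
  let c : ℕ → ℝ := fun n => 1 + ∑ i ∈ Finset.range (n + 1), C i
  have hc : Monotone c := monotone_nat_of_le_succ fun n => by
    simp only [c, Finset.sum_range_succ _ (n + 1)]
    linarith [hC (n + 1)]
  have hc1 : ∀ n, 1 ≤ c n := fun n =>
    le_add_of_nonneg_right (Finset.sum_nonneg fun i _ => (hC i).le)
  have hCc : ∀ n, C n ≤ c n := fun n =>
    (Finset.single_le_sum (f := C) (fun i _ => (hC i).le) (Finset.self_mem_range_succ n)).trans
      (le_add_of_nonneg_left zero_le_one)
  refine ⟨fun g => c (X.find g), fun g => zero_lt_one.trans_le (hc1 _), fun L hL => ?_,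
    fun f hf g h => ?_⟩
  · obtain ⟨n, hn⟩ := X.exists_superset_of_isCompact hL
    exact ⟨c n, fun g hg => hc (X.mem_iff_find_le.1 (hn hg))⟩
  · have h1 : ∀ n, X.find g ≤ n → X.find h ≤ n → ‖f (g * h)‖ ≤ c n := fun n hg hh =>
      (hBC n f hf _ ⟨(g, h), ⟨X.mem_iff_find_le.2 hg, X.mem_iff_find_le.2 hh⟩, rfl⟩).trans (hCc n)
    rcases le_total (X.find g) (X.find h) with hgh | hgh
    · exact (h1 _ hgh le_rfl).trans
        (le_mul_of_one_le_left (zero_le_one.trans (hc1 _)) (hc1 _))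
    · exact (h1 _ le_rfl hgh).trans
        (le_mul_of_one_le_right (zero_le_one.trans (hc1 _)) (hc1 _))

variable [LieGroup 𝓘(ℂ, E) ω G] [FiniteDimensional ℂ E]

/-- On a bounded set, a convolution is controlled by both factors on one larger bounded set. -/
theorem exists_norm_mul_le [WeaklyLocallyCompactSpace G] [SigmaCompactSpace G]
    {B : Set (HolomorphicFunctions E G)} (hB : IsVonNBounded ℂ B) :
    ∃ B' : Set (HolomorphicFunctions E G), IsVonNBounded ℂ B' ∧
      ∀ (α β : AnalyticFunctional E G) (a b : ℝ), (∀ f ∈ B', ‖α f‖ ≤ a) → (∀ f ∈ B', ‖β f‖ ≤ b) →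
        ∀ f ∈ B, ‖(α * β) f‖ ≤ a * b := by
  have hG : IsTopologicalGroup G := topologicalGroup_of_lieGroup 𝓘(ℂ, E) ω
  obtain ⟨w, hw, hwL, hwB⟩ := hB.exists_weight
  refine ⟨{f | ∀ x, ‖f x‖ ≤ w x}, HolomorphicFunctions.isVonNBounded_iff.2 fun L hL => ?_,
    fun α β a b hα hβ f hf => ?_⟩
  · obtain ⟨C, hC⟩ := hwL L hL
    exact ⟨C, fun f hf x hx => (hf x).trans (hC x hx)⟩
  · have hb : 0 ≤ b := (norm_nonneg _).trans (hβ 0 fun x => (norm_zero (E := ℂ)).le.trans (hw x).le)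
    refine norm_apply_le_mul hα hb fun g => ?_
    rw [mul_comm]
    refine norm_apply_le_mul hβ (hw g).le fun h => ?_
    rw [leftTranslate_apply, mul_comm]
    exact hwB f hf g h

instance [WeaklyLocallyCompactSpace G] [SigmaCompactSpace G] :
    IsTopologicalRing (AnalyticFunctional E G) := by
  refine IsTopologicalRing.of_addGroup_of_nhds_zero ?_ ?_ ?_
  · refine ((hasBasis_nhds_zero.prod_self).tendsto_iff hasBasis_nhds_zero).2 fun B hB => ?_
    obtain ⟨B', hB', h⟩ := exists_norm_mul_le hB
    exact ⟨B', hB', fun p hp f hf =>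
      (h p.1 p.2 1 1 hp.1 hp.2 f hf).trans (one_mul 1).le⟩
  · refine fun α => (hasBasis_nhds_zero.tendsto_iff hasBasis_nhds_zero).2 fun B hB => ?_
    obtain ⟨B', hB', h⟩ := exists_norm_mul_le hB
    obtain ⟨C, hC, hα⟩ := exists_norm_apply_le_of_isVonNBounded α hB'
    refine ⟨_, hB'.image ((C : ℂ) • ContinuousLinearMap.id ℂ (HolomorphicFunctions E G)),
      fun β hβ f hf => ?_⟩
    refine (h α β C C⁻¹ hα (fun f hf => ?_) f hf).trans (mul_inv_cancel₀ hC.ne').le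
    have h1 : ‖β ((C : ℂ) • f)‖ ≤ 1 := hβ _ ⟨f, hf, rfl⟩
    rw [map_smul, norm_smul, Complex.norm_real, Real.norm_of_nonneg hC.le] at h1
    rwa [inv_eq_one_div, le_div_iff₀' hC]
  · refine fun α => (hasBasis_nhds_zero.tendsto_iff hasBasis_nhds_zero).2 fun B hB => ?_
    obtain ⟨B', hB', h⟩ := exists_norm_mul_le hB
    obtain ⟨C, hC, hα⟩ := exists_norm_apply_le_of_isVonNBounded α hB'
    refine ⟨_, hB'.image ((C : ℂ) • ContinuousLinearMap.id ℂ (HolomorphicFunctions E G)),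
      fun β hβ f hf => ?_⟩
    refine (h β α C⁻¹ C (fun f hf => ?_) hα f hf).trans (inv_mul_cancel₀ hC.ne').le
    have h1 : ‖β ((C : ℂ) • f)‖ ≤ 1 := hβ _ ⟨f, hf, rfl⟩
    rw [map_smul, norm_smul, Complex.norm_real, Real.norm_of_nonneg hC.le] at h1
    rwa [inv_eq_one_div, le_div_iff₀' hC]

instance [WeaklyLocallyCompactSpace G] [SigmaCompactSpace G] :
    IsTensorHatAlgebra (AnalyticFunctional E G) where

instance [WeaklyLocallyCompactSpace G] [SigmaCompactSpace G] :
    IsTensorHatBimodule (AnalyticFunctional E G) (AnalyticFunctional E G) where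
  isScalarTower_left := inferInstance
  isScalarTower_right := inferInstance
  smulCommClass := inferInstance
  continuousSMul_left := inferInstance
  continuousSMul_right := inferInstance

end Multiplication

end AnalyticFunctional

/-! ### Holomorphic families of delta functions -/

namespace AnalyticFunctional

section Derivative

variable {E : Type*} [NormedAddCommGroup E] [NormedSpace ℂ E]
  {M : Type*} [TopologicalSpace M] [ChartedSpace E M]
  {V : Type*} [NormedAddCommGroup V] [NormedSpace ℂ V] [FiniteDimensional ℂ V]

/-- Along a holomorphic map `τ` from a ball into `M`, the functional `δ_{τ z}` has a first-order
expansion at the centre, in which the linear term is again an analytic functional and the remainder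
is quadratically small, uniformly on each bounded set of holomorphic functions. -/
theorem exists_derivative_delta {τ : V → M} {c : V} {R : ℝ} (hR : 0 < R)
    (hτ : MDifferentiableOn 𝓘(ℂ, V) 𝓘(ℂ, E) τ (Metric.ball c R)) :
    ∃ D : V →ₗ[ℂ] AnalyticFunctional E M,
      ∀ B : Set (HolomorphicFunctions E M), IsVonNBounded ℂ B → ∃ C, 0 < C ∧
        (∀ v, ∀ f ∈ B, ‖D v f‖ ≤ C * ‖v‖) ∧
        ∀ z ∈ Metric.ball c (R / 2),
          (∀ f ∈ B, ‖delta (τ z) f‖ ≤ C) ∧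
          (∀ f ∈ B, ‖(delta (τ z) - delta (τ c) : AnalyticFunctional E M) f‖ ≤ C * ‖z - c‖) ∧
          ∀ f ∈ B, ‖(delta (τ z) - delta (τ c) - D (z - c) : AnalyticFunctional E M) f‖
            ≤ C * ‖z - c‖ ^ 2 := by
  have : ProperSpace V := FiniteDimensional.proper ℂ V
  set r := R / 2 with hr_def
  have hr : 0 < r := by positivity
  have hsub : Metric.closedBall c r ⊆ Metric.ball c R :=
    Metric.closedBall_subset_ball (by linarith)
  have hL : IsCompact (τ '' Metric.closedBall c r) :=
    (isCompact_closedBall c r).image_of_continuousOn (hτ.continuousOn.mono hsub)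
  have hmem : ∀ z ∈ Metric.ball c r, τ z ∈ τ '' Metric.closedBall c r := fun z hz =>
    ⟨z, Metric.ball_subset_closedBall hz, rfl⟩
  have hdiff : ∀ f : HolomorphicFunctions E M, DifferentiableOn ℂ (f ∘ τ) (Metric.ball c r) := by
    intro f
    rw [← mdifferentiableOn_iff_differentiableOn]
    exact f.mdifferentiable.comp_mdifferentiableOn
      (hτ.mono (Metric.ball_subset_closedBall.trans hsub))
  have hda : ∀ f : HolomorphicFunctions E M, DifferentiableAt ℂ (f ∘ τ) c := fun f =>
    (hdiff f).differentiableAt (Metric.ball_mem_nhds c hr)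
  have hbound : ∀ (f : HolomorphicFunctions E M) (C : ℝ),
      (∀ x ∈ τ '' Metric.closedBall c r, ‖f x‖ ≤ C) →
        ∀ v, ‖fderiv ℂ (f ∘ τ) c v‖ ≤ 2 * C / r * ‖v‖ := by
    intro f C hC v
    refine (ContinuousLinearMap.le_opNorm _ _).trans ?_
    gcongr
    exact norm_fderiv_le_of_norm_le_ball hr (hdiff f) fun z hz => hC _ (hmem z hz)
  let D₀ : V → HolomorphicFunctions E M →ₗ[ℂ] ℂ := fun v =>
    { toFun := fun f => fderiv ℂ (f ∘ τ) c v
      map_add' := fun f₁ f₂ => by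
        have : (f₁ + f₂ : HolomorphicFunctions E M) ∘ τ = f₁ ∘ τ + f₂ ∘ τ := rfl
        rw [this, fderiv_add (hda f₁) (hda f₂)]
        rfl
      map_smul' := fun a f => by
        have : (a • f : HolomorphicFunctions E M) ∘ τ = a • (f ∘ τ) := rfl
        rw [this, fderiv_const_smul (hda f)]
        rfl }
  have hD₀ : ∀ v, Continuous (D₀ v) := by
    intro v
    refine continuous_of_continuousAt_zero (D₀ v) ?_
    rw [ContinuousAt, map_zero, (HolomorphicFunctions.hasBasis_nhds_zero.tendsto_iff
      Metric.nhds_basis_closedBall)]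
    intro ε hε
    refine ⟨(_, ε * r / (2 * (‖v‖ + 1))), ⟨hL, by positivity⟩, fun f hf => ?_⟩
    rw [mem_closedBall_zero_iff]
    refine (hbound f _ (fun x hx => (hf x hx).le) v).trans ?_
    calc 2 * (ε * r / (2 * (‖v‖ + 1))) / r * ‖v‖ = ε * (‖v‖ / (‖v‖ + 1)) := by field_simp
      _ ≤ ε := mul_le_of_le_one_right hε.le (div_le_one_of_le₀ (by linarith) (by positivity))
  let D : V →ₗ[ℂ] AnalyticFunctional E M :=
    { toFun := fun v => (⟨D₀ v, hD₀ v⟩ : StrongDual ℂ (HolomorphicFunctions E M))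
      map_add' := fun v w => ext fun f => (fderiv ℂ (f ∘ τ) c).map_add v w
      map_smul' := fun a v => ext fun f => (fderiv ℂ (f ∘ τ) c).map_smul a v }
  refine ⟨D, fun B hB => ?_⟩
  obtain ⟨C, hC, hBC⟩ := hB.exists_norm_apply_le hL
  have hC1 : C ≤ max C (max (2 * C / r) (4 * C / r ^ 2)) := le_max_left _ _
  have hC2 : 2 * C / r ≤ max C (max (2 * C / r) (4 * C / r ^ 2)) :=
    (le_max_left _ _).trans (le_max_right _ _)
  have hC3 : 4 * C / r ^ 2 ≤ max C (max (2 * C / r) (4 * C / r ^ 2)) :=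
    (le_max_right _ _).trans (le_max_right _ _)
  refine ⟨max C (max (2 * C / r) (4 * C / r ^ 2)), lt_max_of_lt_left hC, fun v f hf => ?_,
    fun z hz => ⟨fun f hf => (hBC f hf _ (hmem z hz)).trans hC1, fun f hf => ?_, fun f hf => ?_⟩⟩
  · refine (hbound f C (hBC f hf) v).trans ?_
    gcongr
  · have h1 := Complex.dist_le_div_mul_dist_of_mapsTo_ball (hdiff f) (R₂ := 2 * C) (fun w hw => by
      rw [mem_closedBall_iff_norm]
      exact (norm_sub_le _ _).trans ((add_le_add (hBC f hf _ (hmem w hw))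
        (hBC f hf _ (hmem c (Metric.mem_ball_self hr)))).trans (two_mul C).ge)) hz
    rw [dist_eq_norm_sub, dist_eq_norm_sub] at h1
    exact h1.trans (by gcongr)
  · have h1 := norm_sub_sub_fderiv_le hr (hdiff f) (fun w hw => hBC f hf _ (hmem w hw)) hz
    refine h1.trans ?_
    calc 4 * C * (‖z - c‖ / r) ^ 2 = 4 * C / r ^ 2 * ‖z - c‖ ^ 2 := by field_simp
      _ ≤ _ := by gcongr

/-- A jointly continuous bilinear form on `𝒜(M)` is controlled by the values of both arguments on
one bounded set. -/
theorem exists_norm_bilinear_le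
    (T : AnalyticFunctional E M →ₗ[ℂ] AnalyticFunctional E M →ₗ[ℂ] ℂ)
    (hT : Continuous fun p : AnalyticFunctional E M × AnalyticFunctional E M => T p.1 p.2) :
    ∃ B : Set (HolomorphicFunctions E M), IsVonNBounded ℂ B ∧
      ∀ (α β : AnalyticFunctional E M) (a b : ℝ), 0 < a → 0 < b →
        (∀ f ∈ B, ‖α f‖ ≤ a) → (∀ f ∈ B, ‖β f‖ ≤ b) → ‖T α β‖ ≤ a * b := by
  have h0 := hT.tendsto (0, 0)
  rw [map_zero, nhds_prod_eq] at h0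
  obtain ⟨B, hB, hBT⟩ := ((hasBasis_nhds_zero.prod_self).tendsto_iff
    Metric.nhds_basis_closedBall).1 h0 1 one_pos
  have hscale : ∀ (α : AnalyticFunctional E M) (a : ℝ), 0 < a → (∀ f ∈ B, ‖α f‖ ≤ a) →
      ∀ f ∈ B, ‖((a : ℂ)⁻¹ • α) f‖ ≤ 1 := by
    intro α a ha h f hf
    rw [smul_apply, norm_mul, norm_inv, Complex.norm_real, Real.norm_of_nonneg ha.le,
      inv_mul_le_iff₀ ha, mul_one]
    exact h f hf
  refine ⟨B, hB, fun α β a b ha hb hα hβ => ?_⟩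
  have h1 := hBT ((a : ℂ)⁻¹ • α, (b : ℂ)⁻¹ • β) ⟨hscale α a ha hα, hscale β b hb hβ⟩
  simp only [mem_closedBall_zero_iff, map_smul, LinearMap.smul_apply, norm_smul, norm_inv,
    Complex.norm_real, Real.norm_of_nonneg ha.le, Real.norm_of_nonneg hb.le] at h1
  rwa [inv_mul_le_iff₀ hb, inv_mul_le_iff₀ ha, mul_one] at h1

/-- The product rule for `T(δ_{τ₁ z}, δ_{τ₂ z})`: the expansions of the two arguments are
multiplied, and all terms beyond the linear ones are quadratically small. -/
theorem differentiableAt_bilinear_delta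
    (T : AnalyticFunctional E M →ₗ[ℂ] AnalyticFunctional E M →ₗ[ℂ] ℂ)
    (hT : Continuous fun p : AnalyticFunctional E M × AnalyticFunctional E M => T p.1 p.2)
    {τ₁ τ₂ : V → M} {c : V} {R : ℝ} (hR : 0 < R)
    (h₁ : MDifferentiableOn 𝓘(ℂ, V) 𝓘(ℂ, E) τ₁ (Metric.ball c R))
    (h₂ : MDifferentiableOn 𝓘(ℂ, V) 𝓘(ℂ, E) τ₂ (Metric.ball c R)) :
    DifferentiableAt ℂ (fun z => T (delta (τ₁ z)) (delta (τ₂ z))) c := by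
  obtain ⟨B, hB, hBT⟩ := exists_norm_bilinear_le T hT
  obtain ⟨D₁, hD₁⟩ := exists_derivative_delta hR h₁
  obtain ⟨D₂, hD₂⟩ := exists_derivative_delta hR h₂
  obtain ⟨C₁, hC₁, hD₁v, hD₁⟩ := hD₁ B hB
  obtain ⟨C₂, hC₂, hD₂v, hD₂⟩ := hD₂ B hB
  have hr : 0 < R / 2 := by positivity
  let L : V →ₗ[ℂ] ℂ := (T.flip (delta (τ₂ c))) ∘ₗ D₁ + (T (delta (τ₁ c))) ∘ₗ D₂
  refine HasFDerivAt.differentiableAt (f' := LinearMap.toContinuousLinearMap L) ?_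
  rw [hasFDerivAt_iff_isLittleO]
  have hO : (fun z => T (delta (τ₁ z)) (delta (τ₂ z)) - T (delta (τ₁ c)) (delta (τ₂ c))
      - LinearMap.toContinuousLinearMap L (z - c)) =O[𝓝 c] fun z => ‖z - c‖ ^ 2 := by
    refine Asymptotics.IsBigO.of_bound (3 * (C₁ * C₂)) ?_
    filter_upwards [Metric.ball_mem_nhds c hr] with z hz
    rcases eq_or_ne z c with rfl | hzc
    · simp
    have hpos : 0 < ‖z - c‖ := norm_pos_iff.2 (sub_ne_zero.2 hzc)
    have e : T (delta (τ₁ z)) (delta (τ₂ z)) - T (delta (τ₁ c)) (delta (τ₂ c))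
        - LinearMap.toContinuousLinearMap L (z - c)
        = T (delta (τ₁ z)) (delta (τ₂ z) - delta (τ₂ c) - D₂ (z - c))
          + T (delta (τ₁ z) - delta (τ₁ c)) (D₂ (z - c))
          + T (delta (τ₁ z) - delta (τ₁ c) - D₁ (z - c)) (delta (τ₂ c)) := by
      simp [L]
      ring
    obtain ⟨h11, h12, h13⟩ := hD₁ z hz
    obtain ⟨h21, h22, h23⟩ := hD₂ z hz
    have k1 := hBT _ _ _ _ hC₁ (by positivity) h11 h23
    have k2 := hBT _ _ _ _ (by positivity) (by positivity) h12 (hD₂v (z - c))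
    have k3 := hBT _ _ _ _ (by positivity) hC₂ h13 (hD₂ c (Metric.mem_ball_self hr)).1
    rw [e, Real.norm_of_nonneg (by positivity)]
    refine norm_add₃_le.trans ?_
    linarith
  refine hO.trans_isLittleO ?_
  have h0 : (fun z : V => ‖z - c‖ ^ 2) =o[𝓝 c] fun z => ‖z - c‖ ^ 1 :=
    (Asymptotics.isLittleO_pow_pow (𝕜 := ℝ) (m := 1) (n := 2) (by norm_num)).comp_tendsto
      (show Filter.Tendsto (fun z : V => ‖z - c‖) (𝓝 c) (𝓝 0) from by
        have : Continuous fun z : V => ‖z - c‖ := by fun_prop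
        simpa using this.tendsto c)
  simpa using h0

end Derivative

/-- For a jointly continuous bilinear form `T` on `𝒜(G)`, the function `g ↦ T(δ_g, δ_{g⁻¹})` is
holomorphic. -/
theorem mdifferentiable_bilinear_delta_inv {E : Type*} [NormedAddCommGroup E] [NormedSpace ℂ E]
    [FiniteDimensional ℂ E]
    {G : Type*} [TopologicalSpace G] [ChartedSpace E G] [Group G] [LieGroup 𝓘(ℂ, E) ω G]
    (T : AnalyticFunctional E G →ₗ[ℂ] AnalyticFunctional E G →ₗ[ℂ] ℂ)
    (hT : Continuous fun p : AnalyticFunctional E G × AnalyticFunctional E G => T p.1 p.2) :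
    MDifferentiable 𝓘(ℂ, E) 𝓘(ℂ, ℂ) fun g : G => T (delta g) (delta g⁻¹) := by
  intro g₀
  let e := extChartAt 𝓘(ℂ, E) g₀
  have hopen : IsOpen e.target := isOpen_extChartAt_target g₀
  have hsymm : MDifferentiableOn 𝓘(ℂ, E) 𝓘(ℂ, E) e.symm e.target :=
    (contMDiffOn_extChartAt_symm (n := 1) g₀).mdifferentiableOn one_ne_zero
  obtain ⟨R, hR, hball⟩ := Metric.isOpen_iff.1 hopen _ (mem_extChartAt_target (I := 𝓘(ℂ, E)) g₀)
  have hinv : MDifferentiable 𝓘(ℂ, E) 𝓘(ℂ, E) fun g : G => g⁻¹ :=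
    (contMDiff_inv 𝓘(ℂ, E) ω).mdifferentiable (by simp)
  have key := differentiableAt_bilinear_delta T hT hR (hsymm.mono hball)
    (hinv.comp_mdifferentiableOn (hsymm.mono hball))
  refine MDifferentiableAt.congr_of_eventuallyEq
    (key.mdifferentiableAt.comp g₀ (mdifferentiableAt_extChartAt (mem_chart_source E g₀))) ?_
  filter_upwards [extChartAt_source_mem_nhds (I := 𝓘(ℂ, E)) g₀] with g hg
  simp only [Function.comp_apply]
  rw [e.left_inv hg]

end AnalyticFunctional

/-! ### Integration in complete locally convex spaces -/

section WeakIntegral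

open MeasureTheory

variable {X : Type*} [AddCommGroup X] [Module ℂ X] [UniformSpace X] [IsCompleteLocallyConvex X]

theorem eq_of_forall_continuousLinearMap_eq {x y : X} (h : ∀ ℓ : X →L[ℂ] ℂ, ℓ x = ℓ y) :
    x = y := by
  by_contra hxy
  obtain ⟨ℓ, hℓ⟩ := RCLike.geometric_hahn_banach_point_point (𝕜 := ℂ) hxy
  exact hℓ.ne (by rw [h])

/-- A continuous map from a compact probability space into a complete locally convex space has a
weak integral. The closed absolutely convex hull of its image is compact, so it suffices to find,
for finitely many functionals at a time, a point of the hull with the prescribed values. -/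
theorem exists_forall_eq_integral {K : Type*} [TopologicalSpace K] [CompactSpace K]
    [MeasurableSpace K] [BorelSpace K] (μ : Measure K) [IsProbabilityMeasure μ] {f : K → X}
    (hf : Continuous f) : ∃ x : X, ∀ ℓ : X →L[ℂ] ℂ, ℓ x = ∫ k, ℓ (f k) ∂μ := by
  have : ContinuousSMul ℝ X := IsScalarTower.continuousSMul (M := ℝ) (α := X) ℂ
  have hC : IsCompact (closedAbsConvexHull ℝ (Set.range f)) :=
    isCompact_closedAbsConvexHull_of_totallyBounded (isCompact_range hf).totallyBounded
  obtain ⟨x, -, hx⟩ := hC.inter_iInter_nonempty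
    (fun ℓ : X →L[ℂ] ℂ => {x | ℓ x = ∫ k, ℓ (f k) ∂μ})
    (fun ℓ => isClosed_eq ℓ.continuous continuous_const) fun u => by
      let T : X →L[ℂ] (u → ℂ) := ContinuousLinearMap.pi fun ℓ => ℓ.1
      have hTf : Continuous fun k => T (f k) := T.continuous.comp hf
      have h1 : ∫ k, T (f k) ∂μ ∈ T '' closedAbsConvexHull ℝ (Set.range f) :=
        ((absConvex_convexClosedHull (𝕜 := ℝ)).2.linear_image
          (T.restrictScalars ℝ).toLinearMap).integral_mem (hC.image T.continuous).isClosed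
          (.of_forall fun k => ⟨f k, subset_closedAbsConvexHull ⟨k, rfl⟩, rfl⟩)
          (hTf.integrable_of_hasCompactSupport (.of_compactSpace _))
      obtain ⟨x, hxC, hx⟩ := h1
      refine ⟨x, hxC, Set.mem_iInter₂.2 fun ℓ hℓ => ?_⟩
      have h2 := eval_integral (μ := μ) (f := fun k => T (f k)) (fun i =>
        ((continuous_apply i).comp hTf).integrable_of_hasCompactSupport (.of_compactSpace _))
        ⟨ℓ, hℓ⟩
      exact (congrFun hx ⟨ℓ, hℓ⟩).trans h2
  exact ⟨x, fun ℓ => Set.mem_iInter.1 hx ℓ⟩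

end WeakIntegral

/-! ### Conjugation on bimodules -/

namespace AnalyticFunctional

open MulOpposite

variable {E : Type*} [NormedAddCommGroup E] [NormedSpace ℂ E] [FiniteDimensional ℂ E]
  {G : Type*} [TopologicalSpace G] [ChartedSpace E G] [Group G] [LieGroup 𝓘(ℂ, E) ω G]
  {X : Type*} [AddCommGroup X] [Module ℂ X] [UniformSpace X] [Module (AnalyticFunctional E G) X]
  [Module (AnalyticFunctional E G)ᵐᵒᵖ X] [IsTensorHatBimodule (AnalyticFunctional E G) X]

/-- Left multiplication by `a` followed by right multiplication by `b`, as an operator on a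
bimodule. -/
def sandwich (a b : AnalyticFunctional E G) : X →L[ℂ] X where
  toFun x := a • op b • x
  map_add' x y := by simp only [smul_add]
  map_smul' c x := by simp only [smul_comm _ c, RingHom.id_apply]
  cont := (continuous_const_smul a).comp (continuous_const_smul (op b))

theorem sandwich_apply (a b : AnalyticFunctional E G) (x : X) :
    sandwich a b x = a • op b • x := rfl

theorem continuous_sandwich (x : X) :
    Continuous fun p : AnalyticFunctional E G × AnalyticFunctional E G => sandwich p.1 p.2 x :=
  continuous_fst.smul ((continuous_op.comp continuous_snd).smul continuous_const)

/-- The action of `g` on a bimodule by `x ↦ δ_g x δ_{g⁻¹}`. -/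
def conj (g : G) : X →L[ℂ] X := sandwich (E := E) (delta g) (delta g⁻¹)

theorem conj_apply (g : G) (x : X) :
    conj (E := E) g x
      = (delta g : AnalyticFunctional E G) • op (delta g⁻¹ : AnalyticFunctional E G) • x := rfl

theorem conj_mul_apply (g h : G) (x : X) :
    conj (E := E) (g * h) x = conj (E := E) g (conj (E := E) h x) := by
  simp only [conj_apply]
  rw [← smul_comm (delta h : AnalyticFunctional E G) (op _), smul_smul, smul_smul, ← op_mul,
    delta_mul_delta, delta_mul_delta, mul_inv_rev]

theorem delta_smul_eq_of_conj_eq {g : G} {x : X} (h : conj (E := E) g x = x) :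
    (delta g : AnalyticFunctional E G) • x = op (delta g : AnalyticFunctional E G) • x := by
  conv_rhs => rw [← h, conj_apply, ← smul_comm (delta g : AnalyticFunctional E G) (op _),
    smul_smul (op _), ← op_mul, delta_mul_delta, inv_mul_cancel]
  exact congrArg _ (one_smul _ x).symm

theorem continuous_conj (x : X) : Continuous fun g : G => conj (E := E) g x :=
  have : IsTopologicalGroup G := topologicalGroup_of_lieGroup 𝓘(ℂ, E) ω
  (continuous_sandwich x).comp (continuous_delta.prodMk (continuous_delta.comp continuous_inv))

/-- The matrix coefficients of the conjugation action are holomorphic. -/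
theorem mdifferentiable_conj (ℓ : X →L[ℂ] ℂ) (x : X) :
    MDifferentiable 𝓘(ℂ, E) 𝓘(ℂ, ℂ) fun g : G => ℓ (conj (E := E) g x) :=
  mdifferentiable_bilinear_delta_inv
    (LinearMap.mk₂ ℂ (fun a b : AnalyticFunctional E G => ℓ (sandwich a b x))
      (fun a a' b => by rw [← map_add]; exact congrArg ℓ (add_smul a a' _))
      (fun c a b => by rw [← map_smul]; exact congrArg ℓ (smul_assoc c a _))
      (fun a b b' => by simp only [← map_add, sandwich_apply, op_add, add_smul, smul_add])
      (fun c a b => by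
        simp only [← map_smul, sandwich_apply, op_smul, smul_assoc, smul_comm a c]))
    (ℓ.continuous.comp (continuous_sandwich x))

theorem _root_.IsBimoduleMorphism.map_conj {Y : Type*} [AddCommGroup Y] [Module ℂ Y]
    [UniformSpace Y] [Module (AnalyticFunctional E G) Y] [Module (AnalyticFunctional E G)ᵐᵒᵖ Y]
    [IsTensorHatBimodule (AnalyticFunctional E G) Y] {σ : X →L[ℂ] Y}
    (hσ : IsBimoduleMorphism (AnalyticFunctional E G) σ) (g : G) (x : X) :
    σ (conj (E := E) g x) = conj (E := E) g (σ x) := by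
  rw [conj_apply, hσ.map_smul_left, hσ.map_smul_right, ← conj_apply]

/-- An element of a bimodule that commutes with all functionals `δ_g` is central. -/
theorem smul_eq_op_smul_of_conj_eq [T2Space G] {x : X} (h : ∀ g : G, conj (E := E) g x = x)
    (a : AnalyticFunctional E G) : a • x = op a • x := by
  have : LocallyCompactSpace G := Manifold.locallyCompact_of_finiteDimensional 𝓘(ℂ, E)
  let T : AnalyticFunctional E G →L[ℂ] X :=
    { toFun := fun a => a • x - op a • x
      map_add' := fun a b => by simp only [op_add, add_smul]; abel
      map_smul' := fun c a => by
        simp only [op_smul, smul_assoc, smul_sub, RingHom.id_apply]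
      cont := (continuous_id.smul continuous_const).sub (continuous_op.smul continuous_const) }
  have hT : T = 0 := eq_zero_of_delta T fun g => sub_eq_zero.2 (delta_smul_eq_of_conj_eq (h g))
  exact sub_eq_zero.1 (congrArg (fun S : AnalyticFunctional E G →L[ℂ] X => S a) hT)

end AnalyticFunctional

/-! ### Lifting morphisms by averaging over `K` -/

namespace IsUniversalComplexification

open AnalyticFunctional MeasureTheory MulOpposite

variable {F : Type u} [NormedAddCommGroup F] [NormedSpace ℝ F]
  {K : Type u} [TopologicalSpace K] [ChartedSpace F K] [Group K] [LieGroup 𝓘(ℝ, F) ∞ K]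
  [T2Space K] [CompactSpace K]
  {E : Type u} [NormedAddCommGroup E] [NormedSpace ℂ E] [FiniteDimensional ℂ E]
  {G : Type u} [TopologicalSpace G] [ChartedSpace E G] [Group G] [LieGroup 𝓘(ℂ, E) ω G] [T2Space G]
  {η : K →* G}
  {X : Type w} [AddCommGroup X] [Module ℂ X] [UniformSpace X] [Module (AnalyticFunctional E G) X]
  [Module (AnalyticFunctional E G)ᵐᵒᵖ X] [IsTensorHatBimodule (AnalyticFunctional E G) X]

/-- An element of a bimodule that commutes with the image of `K` is central: the matrix
coefficients of its orbit under conjugation are holomorphic and invariant under `K`. -/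
theorem smul_eq_op_smul (hη : IsUniversalComplexification F E η) {x : X}
    (hx : ∀ k, conj (E := E) (η k) x = x) (a : AnalyticFunctional E G) : a • x = op a • x := by
  refine smul_eq_op_smul_of_conj_eq (fun g => eq_of_forall_continuousLinearMap_eq fun ℓ => ?_) a
  have h1 := hη.apply_eq_apply_one (.mk _ (mdifferentiable_conj (E := E) ℓ x)) (fun g k => by
    simp only [HolomorphicFunctions.mk_apply]
    rw [conj_mul_apply, hx]) g
  have h2 := hη.apply_eq_apply_one (.mk _ (mdifferentiable_conj (E := E) ℓ x)) (fun g k => by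
    simp only [HolomorphicFunctions.mk_apply]
    rw [conj_mul_apply, hx]) (η 1)
  simp only [HolomorphicFunctions.mk_apply, hx] at h1 h2
  rw [h1, h2]

/-- Averaging an element `x₀` of a bimodule over `K` makes it central, and does not change its image
under a morphism if that image is already central. -/
theorem exists_central (hη : IsUniversalComplexification F E η) (x₀ : X)
    {Y : Type v} [AddCommGroup Y] [Module ℂ Y] [UniformSpace Y] [Module (AnalyticFunctional E G) Y]
    [Module (AnalyticFunctional E G)ᵐᵒᵖ Y] [IsTensorHatBimodule (AnalyticFunctional E G) Y]
    {σ : X →L[ℂ] Y} (hσ : IsBimoduleMorphism (AnalyticFunctional E G) σ)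
    (hσx : ∀ g : G, conj (E := E) g (σ x₀) = σ x₀) :
    ∃ x : X, σ x = σ x₀ ∧ ∀ a : AnalyticFunctional E G, a • x = op a • x := by
  have : IsTopologicalGroup K := topologicalGroup_of_lieGroup 𝓘(ℝ, F) ∞
  let _ : MeasurableSpace K := borel K
  have : BorelSpace K := ⟨rfl⟩
  let μ : Measure K := Measure.haarMeasure ⊤
  have hμ : IsProbabilityMeasure μ := ⟨Measure.haarMeasure_self⟩
  obtain ⟨x, hx⟩ := exists_forall_eq_integral (X := X) μ (f := fun k => conj (E := E) (η k) x₀)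
    ((continuous_conj x₀).comp hη.contMDiff.continuous)
  refine ⟨x, eq_of_forall_continuousLinearMap_eq fun ℓ => ?_, hη.smul_eq_op_smul fun h =>
    eq_of_forall_continuousLinearMap_eq fun ℓ => ?_⟩
  · have h1 := hx (ℓ.comp σ)
    simpa only [ContinuousLinearMap.comp_apply, hσ.map_conj, hσx, integral_const, probReal_univ,
      one_smul] using h1
  · have h1 := hx (ℓ.comp (conj (E := E) (η h)))
    simp only [ContinuousLinearMap.comp_apply, ← conj_mul_apply, ← map_mul] at h1
    rw [h1, hx ℓ]
    exact integral_mul_left_eq_self (μ := μ) (fun k => ℓ (conj (E := E) (η k) x₀)) h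

end IsUniversalComplexification

end

theorem mainTheorem5 (E : Type u) [NormedAddCommGroup E] [NormedSpace ℂ E]
    [FiniteDimensional ℂ E]
    (G : Type u) [TopologicalSpace G] [ChartedSpace E G] [Group G] [LieGroup 𝓘(ℂ, E) ω G]
    [T2Space G] (hG : IsLinearlyComplexReductive E G) :
    IsHomologicallyTrivial.{w, u} (AnalyticFunctional E G) := by
  obtain ⟨F, _, _, _, K, _, _, _, _, _, _, η, hη⟩ := hG
  have : LocallyCompactSpace G := Manifold.locallyCompact_of_finiteDimensional 𝓘(ℂ, E)
  have : SigmaCompactSpace G := hη.sigmaCompactSpace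
  refine ⟨inferInstance, inferInstance, ?_⟩
  intro X _ _ _ _ _ _ Y _ _ _ _ _ _ σ s φ hσ hs hφ
  have hs' : ∀ y, σ (s y) = y := fun y => DFunLike.congr_fun hs y
  have hφ1 : ∀ g : G, AnalyticFunctional.conj (E := E) g (φ 1) = φ 1 := fun g => by
    rw [← hφ.map_conj, AnalyticFunctional.conj_apply, op_smul_eq_mul, one_mul,
      smul_eq_mul, AnalyticFunctional.delta_mul_delta, mul_inv_cancel]
    rfl
  obtain ⟨x, hx, hxc⟩ := hη.exists_central (s (φ 1)) hσ fun g => by rw [hs', hφ1]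
  let τ : AnalyticFunctional E G →L[ℂ] X :=
    { toFun := fun a => a • x
      map_add' := fun a b => add_smul a b x
      map_smul' := fun c a => smul_assoc c a x
      cont := continuous_id.smul continuous_const }
  refine ⟨τ, ⟨fun a b => mul_smul a b x, fun a b => ?_⟩, ContinuousLinearMap.ext fun a => ?_⟩
  · change (b * a) • x = MulOpposite.op a • b • x
    rw [mul_smul, hxc, smul_comm b]
  · change σ (a • x) = φ a
    rw [hσ.map_smul_left, hx, hs', ← hφ.map_smul_left, smul_eq_mul, mul_one]
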